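/- For an integer $d\ge 1$ consider $\mathbb Z^d$ with the graph structure in which $u\sim v$ iff $\|u-v\|_1=1$, and let $E(\mathbb Z^d)$ be its set of (unordered) edges. A \emph{shift} is a function $\tau:\mathbb Z^d\to\mathbb Z$ which equals zero except at finitely many vertices; $\mathcal S$ denotes the set of all shifts. The \emph{total variation} of a shift $\tau$ is $$\mathrm{TV}(\tau):=\sum_{\{u,v\}\in E(\mathbb Z^d)}|\tau(u)-\tau(v)| .$$ A \emph{level component} of $\tau$ is a (non-empty) connected subset of $\mathbb Z^d$ on which $\tau$ is constant and which is maximal under inclusion among such sets. The \emph{trip entropy} $R(\tau)$ is the minimum of $\sum_{i=1}^{n}\|v_i-v_{i-1}\|_1$ over all finite sequences $v_0,v_1,\dots,v_n$ of points of $\mathbb Z^d$ with $v_0=0$ such that every level component of $\tau$ contains at least one of the points $v_0,\dots,v_n$. \textbf{Proposition (Counting shift functions).} There exists a universal constant $C>0$ such that for every dimension $d\ge 2$ and all real $\lambda,\rho>0$ the set $\{\tau\in\mathcal S:\ \mathrm{TV}(\tau)\le\lambda,\ R(\tau)\le\rho\}$ is finite and $$\bigl|\{\tau\in\mathcal S:\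 \mathrm{TV}(\tau)\le\lambda,\ R(\tau)\le\rho\}\bigr|\le \exp\left(C\min\left\{\lambda+\lambda\log\left(\frac{\rho}{\lambda}+1\right),\ \lambda\frac{\log d}{d}+\rho\log d\right\}\right).$$ -/

import Mathlib

namespace LatticeShift

/-- The `ℓ¹` distance on `ℤ^d`, as a natural number. -/
def l1Dist {d : ℕ} (u v : Fin d → ℤ) : ℕ := ∑ i, (u i - v i).natAbs

lemma l1Dist_comm {d : ℕ} (u v : Fin d → ℤ) : l1Dist u v = l1Dist v u :=
  Finset.sum_congr rfl fun i _ => by omega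

/-- The lattice graph on `ℤ^d`: `u ∼ v` iff `‖u - v‖₁ = 1`. -/
def lattice (d : ℕ) : SimpleGraph (Fin d → ℤ) where
  Adj u v := l1Dist u v = 1
  symm := ⟨fun u v h => by rw [l1Dist_comm]; exact h⟩
  loopless := ⟨fun u h => by simp [l1Dist] at h⟩

/-- A shift: an integer-valued function on `ℤ^d` which is zero outside a finite set. -/
abbrev Shift (d : ℕ) : Type := (Fin d → ℤ) →₀ ℤ

/-- The absolute difference `|τ(u) - τ(v)|` across an unordered pair `{u, v}`. -/
def edgeDiff {d : ℕ} (τ : Shift d) (e : Sym2 (Fin d → ℤ)) : ℕ :=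
  Sym2.lift ⟨fun u v => (τ u - τ v).natAbs, fun u v => by beta_reduce; omega⟩ e

/-- The total variation of `τ`: the sum of `|τ(u) - τ(v)|` over all edges `{u, v}` of `ℤ^d`
(only finitely many terms are nonzero, see `finite_support_edgeDiff`). -/
noncomputable def totalVariation {d : ℕ} (τ : Shift d) : ℕ :=
  ∑ᶠ e ∈ (lattice d).edgeSet, edgeDiff τ e

/-- The level components of `τ`: the maximal connected sets on which `τ` is constant.
(Connected sets are non-empty.) -/
def levelComponents {d : ℕ} (τ : Shift d) : Set (Set (Fin d → ℤ)) :=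
  {A | Maximal (fun B : Set (Fin d → ℤ) =>
    ((lattice d).induce B).Connected ∧ ∃ k : ℤ, ∀ v ∈ B, τ v = k) A}

/-- `v₀, …, vₙ` is a root sequence for the collection `F` of subsets of `ℤ^d`: it starts at the
origin and visits every member of `F`. -/
def IsRootSequence {d n : ℕ} (F : Set (Set (Fin d → ℤ))) (v : Fin (n + 1) → Fin d → ℤ) : Prop :=
  v 0 = 0 ∧ ∀ A ∈ F, ∃ i, v i ∈ A

/-- The length `∑_{i = 1}^{n} ‖vᵢ - vᵢ₋₁‖₁` of a finite sequence `v₀, …, vₙ` in `ℤ^d`. -/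
def tripLength {d n : ℕ} (v : Fin (n + 1) → Fin d → ℤ) : ℕ :=
  ∑ i : Fin n, l1Dist (v i.succ) (v i.castSucc)

/-- The trip entropy of `τ`: the least length of a root sequence for its level components
(such sequences exist, so the infimum is attained, see `exists_tripLength_eq_tripEntropy`). -/
noncomputable def tripEntropy {d : ℕ} (τ : Shift d) : ℕ :=
  sInf {m | ∃ (n : ℕ) (v : Fin (n + 1) → Fin d → ℤ),
    IsRootSequence (levelComponents τ) v ∧ tripLength v = m}

lemma finite_neighborSet {d : ℕ} (u : Fin d → ℤ) : ((lattice d).neighborSet u).Finite := by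
  refine (Set.finite_Icc (u - 1) (u + 1)).subset fun v hv => ?_
  have hv : l1Dist u v = 1 := hv
  have h (i : Fin d) : (u i - v i).natAbs ≤ 1 :=
    hv ▸ Finset.single_le_sum (f := fun i => (u i - v i).natAbs) (fun _ _ => Nat.zero_le _)
      (Finset.mem_univ i)
  constructor <;> intro i <;> have := h i <;> simp <;> omega

/-- Only finitely many edges contribute to the total variation. -/
lemma finite_support_edgeDiff {d : ℕ} (τ : Shift d) :
    ((lattice d).edgeSet ∩ Function.support (edgeDiff τ)).Finite := by
  have hT : (⋃ u ∈ (τ.support : Set (Fin d → ℤ)),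
      (fun v => s(u, v)) '' (lattice d).neighborSet u).Finite :=
    τ.support.finite_toSet.biUnion fun u _ => (finite_neighborSet u).image _
  refine hT.subset ?_
  rintro e ⟨he, hs⟩
  induction e using Sym2.ind with
  | _ u v =>
    have he : (lattice d).Adj u v := he
    have hs : (τ u - τ v).natAbs ≠ 0 := hs
    simp only [Set.mem_iUnion, Set.mem_image]
    by_cases hu : τ u = 0
    · refine ⟨v, by simp; intro h; simp [hu, h] at hs, u, he.symm, Sym2.eq_swap⟩
    · exact ⟨u, by simpa using hu, v, he, rfl⟩

lemma lattice_preconnected (d : ℕ) : (lattice d).Preconnected := by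
  have key : ∀ (n : ℕ) (u v : Fin d → ℤ), l1Dist u v = n → (lattice d).Reachable u v := by
    intro n
    induction n with
    | zero =>
      intro u v h
      have : u = v := by
        funext i
        have := (Finset.sum_eq_zero_iff.1 h) i (Finset.mem_univ i)
        omega
      exact this ▸ SimpleGraph.Reachable.refl _
    | succ n ih =>
      intro u v h
      obtain ⟨i, -, hi⟩ := Finset.exists_ne_zero_of_sum_ne_zero
        (show ∑ i, (u i - v i).natAbs ≠ 0 by unfold l1Dist at h; omega)
      have hw : ∃ a : ℤ, (u i - a).natAbs = 1 ∧ (a - v i).natAbs + 1 = (u i - v i).natAbs := by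
        rcases lt_or_ge (u i) (v i) with h | h
        · exact ⟨u i + 1, by omega, by omega⟩
        · exact ⟨u i - 1, by omega, by omega⟩
      obtain ⟨a, ha, hb⟩ := hw
      have h1 : l1Dist u (Function.update u i a) = 1 := by
        unfold l1Dist
        rw [Finset.sum_eq_single i] <;> simp_all
      have h2 : l1Dist (Function.update u i a) v = n := by
        unfold l1Dist at h ⊢
        rw [← Finset.add_sum_erase _ _ (Finset.mem_univ i)] at h ⊢
        rw [Finset.sum_congr rfl (g := fun j => (u j - v j).natAbs)
          (fun j hj => by rw [Function.update_of_ne (Finset.ne_of_mem_erase hj)])]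
        rw [Function.update_self]
        omega
      have hadj : (lattice d).Adj u (Function.update u i a) := h1
      exact hadj.reachable.trans (ih _ _ h2)
  exact fun u v => key _ u v rfl

/-- The level components of a shift have a root sequence. -/
lemma exists_isRootSequence {d : ℕ} (τ : Shift d) :
    ∃ (n : ℕ) (v : Fin (n + 1) → Fin d → ℤ), IsRootSequence (levelComponents τ) v := by
  classical
  have hT : (((τ.support : Set (Fin d → ℤ)) ∪
      ⋃ u ∈ (τ.support : Set (Fin d → ℤ)), (lattice d).neighborSet u)).Finite :=
    τ.support.finite_toSet.union (τ.support.finite_toSet.biUnion fun u _ => finite_neighborSet u)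
  have key : ∀ A ∈ levelComponents τ, ∃ x ∈ (0 : Fin d → ℤ) :: hT.toFinset.toList, x ∈ A := by
    intro A hA
    obtain ⟨⟨hconn, k, hk⟩, hmax⟩ := hA
    obtain ⟨⟨a, ha⟩⟩ := hconn.nonempty
    by_cases hAu : ∀ v, v ∈ A
    · exact ⟨0, by simp, hAu 0⟩
    push Not at hAu
    obtain ⟨b, hb⟩ := hAu
    obtain ⟨p⟩ := lattice_preconnected d a b
    obtain ⟨e, -, h1, h2⟩ := p.exists_boundary_dart A ha hb
    refine ⟨e.fst, ?_, h1⟩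
    simp only [List.mem_cons, Finset.mem_toList, Set.Finite.mem_toFinset]
    right
    by_cases hu : τ e.fst = 0
    · right
      simp only [Set.mem_iUnion]
      refine ⟨e.snd, ?_, e.adj.symm⟩
      simp only [Finset.mem_coe, Finsupp.mem_support_iff]
      intro hv
      have hc : ((lattice d).induce (A ∪ {e.fst, e.snd})).Connected :=
        SimpleGraph.induce_union_connected hconn.preconnected
          (SimpleGraph.induce_pair_connected_of_adj e.adj).preconnected
          ⟨e.fst, h1, by simp⟩
      have hk0 : k = 0 := by rw [← hk _ h1, hu]
      refine h2 (hmax ⟨hc, 0, ?_⟩ Set.subset_union_left (by simp))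
      rintro v (hvA | rfl | rfl)
      · rw [hk v hvA, hk0]
      · exact hu
      · exact hv
    · left
      simpa using hu
  refine ⟨hT.toFinset.toList.length, fun i => ((0 : Fin d → ℤ) :: hT.toFinset.toList).get i,
    rfl, fun A hA => ?_⟩
  obtain ⟨x, hx, hxA⟩ := key A hA
  obtain ⟨i, rfl⟩ := List.mem_iff_get.1 hx
  exact ⟨i, hxA⟩

/-- The minimum in the definition of the trip entropy is attained. -/
lemma exists_tripLength_eq_tripEntropy {d : ℕ} (τ : Shift d) :
    ∃ (n : ℕ) (v : Fin (n + 1) → Fin d → ℤ),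
      IsRootSequence (levelComponents τ) v ∧ tripLength v = tripEntropy τ := by
  obtain ⟨n, v, hv⟩ := exists_isRootSequence τ
  exact Nat.sInf_mem (s := {m | ∃ (n : ℕ) (v : Fin (n + 1) → Fin d → ℤ),
    IsRootSequence (levelComponents τ) v ∧ tripLength v = m}) ⟨_, n, v, hv, rfl⟩

end LatticeShift

/-! A shift vanishes on its infinite level components, so it is encoded by its finite ones. Filling
the holes of a finite level component gives its hull, a finite connected set with connected
complement (`isContour_hull`). The family of hulls recovers the components
(`mem_levelComp_iff_hull`); adding the jump of the shift across one extremal boundary edge of each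
hull recovers the shift itself (`IsTransversal.eq_of_hull`). Boundary edges of distinct hulls lie on
distinct darts that carry nonzero jumps, so the boundary sizes add up to at most `2 * lam`. As every
hull has at least `2 * d` boundary edges, there are at most `lam / d` hulls.

The geometric core is `card_contours_le`: a contour through a given vertex with `b` boundary edges
can be chosen in `exp (O (b * log d / d))` ways. A double count over unit squares yields a set `D`
of `O (b / d)` boundary vertices which, with a subset `U` and the trace of the contour on `D`,
determines the contour near its boundary (`exists_isCore`). What stays undetermined is constant on
the components of the remaining region, and `O (b / d)` further marked points settle those
(`IsCore.eq_of_badPoints`). The boundary of a contour is connected through unit squares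
(`IsContour.boundary_connected`, a vanishing of cohomology mod 2), so all recorded points lie on one
lattice walk of length `O (b / d)`, with `2 * d` choices per step.

It remains to choose a vertex in each hull. These are read off an optimal trip
(`exists_isTransversal`) and counted by an exponential Markov inequality with a free parameter `q`
(`card_trips_le`). Boundary sizes and jumps are counted the same way. `card_shifts_le` combines
everything, and the two terms of the minimum come from `q = rho / (rho + lam)` and `q = 1 / d ^ 2`.
-/

namespace LatticeShift

/-! ### Unit steps and connectivity along level sets -/

/-- The directions of `ℤ^d`. -/
abbrev Dir (d : ℕ) : Type := Fin d × Bool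

/-- The unit vector in a given direction. -/
def stepVec {d : ℕ} (a : Dir d) : Fin d → ℤ := Pi.single a.1 (if a.2 then 1 else -1)

/-- The opposite direction. -/
def Dir.opp {d : ℕ} (a : Dir d) : Dir d := (a.1, !a.2)

@[simp] lemma stepVec_opp {d : ℕ} (a : Dir d) : stepVec a.opp = -stepVec a := by
  rcases a with ⟨i, _ | _⟩ <;> simp [stepVec, Dir.opp, Pi.single_neg]

@[simp] lemma Dir.opp_opp {d : ℕ} (a : Dir d) : a.opp.opp = a := by
  rcases a with ⟨i, _ | _⟩ <;> rfl

lemma stepVec_injective {d : ℕ} : Function.Injective (stepVec (d := d)) := by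
  rintro ⟨i, s⟩ ⟨j, t⟩ h
  have h1 := congrFun h i
  have h2 := congrFun h j
  by_cases hij : i = j
  · subst hij
    cases s <;> cases t <;> simp [stepVec] at h1 ⊢
  · cases s <;> simp [stepVec, hij] at h1

lemma l1Dist_self {d : ℕ} (u : Fin d → ℤ) : l1Dist u u = 0 := by simp [l1Dist]

lemma l1Dist_triangle {d : ℕ} (u v w : Fin d → ℤ) :
    l1Dist u w ≤ l1Dist u v + l1Dist v w := by
  unfold l1Dist
  rw [← Finset.sum_add_distrib]
  exact Finset.sum_le_sum fun i _ => by omega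

lemma l1Dist_add_stepVec {d : ℕ} (u : Fin d → ℤ) (a : Dir d) :
    l1Dist u (u + stepVec a) = 1 := by
  unfold l1Dist
  rw [Finset.sum_eq_single a.1]
  · rcases a with ⟨i, _ | _⟩ <;> simp [stepVec]
  · intro j _ hj
    simp [stepVec, hj]
  · simp

lemma adj_add_stepVec {d : ℕ} (u : Fin d → ℤ) (a : Dir d) :
    (lattice d).Adj u (u + stepVec a) := l1Dist_add_stepVec u a

lemma exists_stepVec_of_lt {d : ℕ} {u v : Fin d → ℤ} {n : ℕ} (h : l1Dist u v = n + 1) :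
    ∃ a : Dir d, u a.1 ≠ v a.1 ∧ l1Dist (u + stepVec a) v = n := by
  obtain ⟨i, -, hi⟩ := Finset.exists_ne_zero_of_sum_ne_zero
    (show ∑ i, (u i - v i).natAbs ≠ 0 by unfold l1Dist at h; omega)
  have key : ∀ a : Dir d, a.1 = i →
      ((u + stepVec a) i - v i).natAbs + 1 = (u i - v i).natAbs →
      l1Dist (u + stepVec a) v = n := by
    intro a ha h1
    unfold l1Dist at h ⊢
    rw [← Finset.add_sum_erase _ _ (Finset.mem_univ i)] at h ⊢
    rw [Finset.sum_congr rfl (g := fun j => (u j - v j).natAbs)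
      (fun j hj => by simp [stepVec, ha, Finset.ne_of_mem_erase hj])]
    omega
  rcases lt_or_ge (u i) (v i) with h' | h'
  · exact ⟨(i, true), by simp; omega, key _ rfl (by simp [stepVec]; omega)⟩
  · exact ⟨(i, false), by simp; omega, key _ rfl (by simp [stepVec]; omega)⟩

lemma eq_of_l1Dist_eq_zero {d : ℕ} {u v : Fin d → ℤ} (h : l1Dist u v = 0) : u = v := by
  funext i
  have := (Finset.sum_eq_zero_iff.1 h) i (Finset.mem_univ i)
  omega

lemma exists_stepVec_of_adj {d : ℕ} {u v : Fin d → ℤ} (h : (lattice d).Adj u v) :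
    ∃ a : Dir d, v = u + stepVec a := by
  obtain ⟨a, -, ha⟩ := exists_stepVec_of_lt (n := 0) h
  exact ⟨a, (eq_of_l1Dist_eq_zero ha).symm⟩

/-- The lattice edges along which `φ` is constant. -/
def levelGraph {d : ℕ} {α : Type*} (φ : (Fin d → ℤ) → α) : SimpleGraph (Fin d → ℤ) where
  Adj u v := (lattice d).Adj u v ∧ φ u = φ v
  symm := ⟨fun _ _ h => ⟨h.1.symm, h.2.symm⟩⟩
  loopless := ⟨fun _ h => h.1.ne rfl⟩

lemma levelGraph_adj_add {d : ℕ} {α : Type*} {φ : (Fin d → ℤ) → α} {u : Fin d → ℤ} {a : Dir d}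
    (h : φ u = φ (u + stepVec a)) : (levelGraph φ).Adj u (u + stepVec a) :=
  ⟨adj_add_stepVec u a, h⟩

/-- The common device for comparing components of different colourings: a path for `φ` is also a
path for `ψ` once `ψ` is constant along the `φ`-edges met inside the component of `x`. -/
lemma reachable_of_reachable {d : ℕ} {α β : Type*} {φ : (Fin d → ℤ) → α} {ψ : (Fin d → ℤ) → β}
    {x y : Fin d → ℤ} (h : (levelGraph φ).Reachable x y)
    (hψ : ∀ u v, (levelGraph φ).Reachable x u → (levelGraph φ).Adj u v → ψ u = ψ v) :
    (levelGraph ψ).Reachable x y := by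
  obtain ⟨p⟩ := h
  induction p with
  | nil => exact .refl _
  | @cons u v w huv p ih =>
    have h1 : (levelGraph ψ).Adj u v := ⟨huv.1, hψ u v (.refl _) huv⟩
    exact h1.reachable.trans (ih fun u' v' h h' => hψ u' v' (huv.reachable.trans h) h')

lemma eq_of_reachable {d : ℕ} {α : Type*} {φ : (Fin d → ℤ) → α} {x y : Fin d → ℤ}
    (h : (levelGraph φ).Reachable x y) : φ x = φ y := by
  obtain ⟨p⟩ := h
  induction p with
  | nil => rfl
  | cons huv p ih => exact huv.2.trans ih

/-- A finite non-empty set can be left in every direction, from an extremal point. -/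
lemma exists_exit {d : ℕ} {Z : Set (Fin d → ℤ)} (hZ : Z.Finite) (hne : Z.Nonempty) (a : Dir d) :
    ∃ x ∈ Z, x + stepVec a ∉ Z ∧
      ∀ y ∈ Z, (if a.2 then y a.1 else -y a.1) ≤ (if a.2 then x a.1 else -x a.1) := by
  obtain ⟨x, hx, hmax⟩ := hZ.exists_maximalFor (fun y : Fin d → ℤ => if a.2 then y a.1 else -y a.1) Z
    hne
  have hmax' : ∀ y ∈ Z, (if a.2 then y a.1 else -y a.1) ≤ (if a.2 then x a.1 else -x a.1) := by
    intro y hy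
    rcases le_total (if a.2 then y a.1 else -y a.1) (if a.2 then x a.1 else -x a.1) with h | h
    · exact h
    · exact hmax hy h
  refine ⟨x, hx, fun hx' => ?_, hmax'⟩
  have := hmax' _ hx'
  rcases a with ⟨i, _ | _⟩ <;> simp [stepVec] at this

lemma reachable_of_coord_eq {d : ℕ} {α : Type*} {φ : (Fin d → ℤ) → α} (i : Fin d) (c : ℤ)
    (hφ : ∀ u v : Fin d → ℤ, u i = c → v i = c → φ u = φ v) {x y : Fin d → ℤ}
    (hx : x i = c) (hy : y i = c) : (levelGraph φ).Reachable x y := by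
  have key : ∀ (n : ℕ) (x : Fin d → ℤ), x i = c → l1Dist x y = n →
      (levelGraph φ).Reachable x y := by
    intro n
    induction n with
    | zero =>
      intro x _ h
      exact eq_of_l1Dist_eq_zero h ▸ .refl _
    | succ n ih =>
      intro x hx h
      obtain ⟨a, hne, ha⟩ := exists_stepVec_of_lt h
      have hai : i ≠ a.1 := by rintro rfl; omega
      have hx' : (x + stepVec a) i = c := by simp [stepVec, hai, hx]
      exact (levelGraph_adj_add (hφ _ _ hx hx')).reachable.trans (ih _ hx' ha)
  exact key _ x hx rfl

/-- Far away points are connected to each other outside a bounded set. -/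
lemma exists_far_reachable {d : ℕ} (hd : 2 ≤ d) {A : Set (Fin d → ℤ)} (hA : A.Finite) :
    ∃ n : ℤ, ∀ x y : Fin d → ℤ, (∃ i, n < |x i|) → (∃ i, n < |y i|) →
      (levelGraph (· ∈ A)).Reachable x y := by
  obtain ⟨n, hn0, hn⟩ : ∃ n : ℤ, 0 ≤ n ∧ ∀ z ∈ A, ∀ i, |z i| ≤ n := by
    refine ⟨∑ z ∈ hA.toFinset, ∑ i, |z i|, by positivity, fun z hz i => ?_⟩
    refine le_trans ?_ (Finset.single_le_sum (f := fun z : Fin d → ℤ => ∑ i, |z i|)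
      (fun _ _ => by positivity) (hA.mem_toFinset.2 hz))
    exact Finset.single_le_sum (f := fun i => |z i|) (fun _ _ => by positivity) (Finset.mem_univ i)
  -- A hyperplane at coordinate height beyond `n` misses `A`, hence is connected in its complement.
  -- Hyperplanes in two different directions intersect, which is where `2 ≤ d` enters.
  have hslice : ∀ (i : Fin d) (x y : Fin d → ℤ), n < |x i| → y i = x i →
      (levelGraph (· ∈ A)).Reachable x y := by
    intro i x y hx hy
    refine reachable_of_coord_eq i (x i) ?_ rfl hy
    intro u v hu hv
    have h1 : u ∉ A := fun h => by have := hn u h i; rw [hu] at this; omega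
    have h2 : v ∉ A := fun h => by have := hn v h i; rw [hv] at this; omega
    simp [h1, h2]
  let i0 : Fin d := ⟨0, by omega⟩
  let i1 : Fin d := ⟨1, by omega⟩
  have h01 : i0 ≠ i1 := by simp [i0, i1]
  have hto : ∀ (i j : Fin d) (x : Fin d → ℤ), i ≠ j → n < |x i| →
      (levelGraph (· ∈ A)).Reachable x (Pi.single j (n + 1)) := by
    intro i j x hij hx
    refine (hslice i x (Function.update x j (n + 1)) hx
      (Function.update_of_ne hij _ _)).trans (hslice j _ _ ?_ (by simp))
    rw [Function.update_self, abs_of_pos (by omega)]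
    omega
  have hall : ∀ x : Fin d → ℤ, (∃ i, n < |x i|) →
      (levelGraph (· ∈ A)).Reachable x (Pi.single i0 (n + 1)) := by
    rintro x ⟨i, hi⟩
    by_cases h : i = i0
    · subst h
      refine (hto i0 i1 x h01 hi).trans (hto i1 i0 _ h01.symm ?_)
      rw [Pi.single_eq_same, abs_of_pos (by omega)]
      omega
    · exact hto i i0 x h hi
  exact ⟨n, fun x y hx hy => (hall x hx).trans (hall y hy).symm⟩

/-! ### Cohomology of the lattice modulo two -/

/-- Discrete primitives modulo two. -/
lemma exists_primitive (c : ℤ → ZMod 2) : ∃ g : ℤ → ZMod 2, ∀ t, g (t + 1) = g t + c t := by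
  refine ⟨fun t => ∑ s ∈ Finset.Ico 0 t, c s + ∑ s ∈ Finset.Ico t 0, c s, fun t => ?_⟩
  have h2 : ∀ x : ZMod 2, x + x = 0 := by decide
  beta_reduce
  rcases lt_or_ge t 0 with h | h
  · rw [Finset.Ico_eq_empty (a := (0 : ℤ)) (b := t + 1) (by omega),
      Finset.Ico_eq_empty (a := (0 : ℤ)) (b := t) (by omega),
      ← Finset.insert_Ico_add_one_left_eq_Ico h, Finset.sum_insert (by simp)]
    linear_combination -h2 (c t)
  · rw [Finset.Ico_eq_empty (a := t + 1) (b := 0) (by omega),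
      Finset.Ico_eq_empty (a := t) (b := 0) (by omega),
      ← Finset.insert_Ico_right_eq_Ico_add_one h, Finset.sum_insert (by simp)]
    ring

/-- Every `ℤ/2`-valued cochain which is closed on unit squares is exact. -/
lemma exists_potential {d : ℕ} (c : Fin d → (Fin d → ℤ) → ZMod 2)
    (hc : ∀ i j v, c i v + c j (v + Pi.single i 1) = c j v + c i (v + Pi.single j 1)) :
    ∃ f : (Fin d → ℤ) → ZMod 2, ∀ i v, f (v + Pi.single i 1) = f v + c i v := by
  choose G hG using exists_primitive
  -- Induction on the set of directions in which `c` may be nonzero: integrating along direction `j`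
  -- and subtracting the gradient kills `c j`.
  suffices H : ∀ (I : Finset (Fin d)) (c : Fin d → (Fin d → ℤ) → ZMod 2),
      (∀ i j v, c i v + c j (v + Pi.single i 1) = c j v + c i (v + Pi.single j 1)) →
      (∀ i ∉ I, ∀ v, c i v = 0) →
      ∃ f : (Fin d → ℤ) → ZMod 2, ∀ i v, f (v + Pi.single i 1) = f v + c i v from
    H Finset.univ c hc (by simp)
  intro I
  induction I using Finset.induction_on with
  | empty => exact fun c _ h0 => ⟨0, fun i v => by simp [h0 i (by simp) v]⟩
  | insert j I hj ih =>
    intro c hc h0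
    let g : (Fin d → ℤ) → ZMod 2 := fun v => G (fun t => c j (Function.update v j t)) (v j)
    have hgj : ∀ v, g (v + Pi.single j 1) = g v + c j v := by
      intro v
      have : (fun t => c j (Function.update (v + Pi.single j 1) j t)) =
          fun t => c j (Function.update v j t) := by
        funext t
        congr 1
        ext k
        by_cases hk : k = j
        · subst hk; simp
        · simp [hk]
      simp only [g, this, Pi.add_apply, Pi.single_eq_same, hG, Function.update_eq_self]
    -- If `c i` vanishes, closedness makes `c j` invariant under translation in direction `i`, so
    -- subtracting the gradient of `g` does not revive a direction already killed.
    have hgi : ∀ i, i ≠ j → (∀ v, c i v = 0) → ∀ v, g (v + Pi.single i 1) = g v := by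
      intro i hij hi v
      have : (fun t => c j (Function.update (v + Pi.single i 1) j t)) =
          fun t => c j (Function.update v j t) := by
        funext t
        have := hc i j (Function.update v j t)
        simp only [hi, zero_add, add_zero] at this
        rw [← this]
        congr 1
        ext k
        by_cases hk : k = j
        · subst hk; simp [hij.symm]
        · simp [hk]
      simp only [g, this, Pi.add_apply, Pi.single_eq_of_ne hij.symm, add_zero]
    obtain ⟨f, hf⟩ := ih (fun i v => c i v - (g (v + Pi.single i 1) - g v)) (by
        intro i k v
        have := hc i k v
        have hcomm : v + Pi.single i 1 + Pi.single k 1 = v + Pi.single k 1 + Pi.single i 1 := by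
          ring
        simp only [hcomm]
        linear_combination this) (by
        intro i hi v
        by_cases hij : i = j
        · subst hij; simp only [hgj]; ring
        · have hi' := h0 i (by simp [hij, hi])
          simp only [hi', hgi i hij hi']; ring)
    exact ⟨fun v => f v + g v, fun i v => by simp only [hf]; ring⟩

/-! ### Edge boundaries and the connectivity of contour boundaries -/

/-- The inner boundary darts of a finite set. -/
def edgeBoundary {d : ℕ} (F : Finset (Fin d → ℤ)) : Finset ((Fin d → ℤ) × Dir d) :=
  (F ×ˢ Finset.univ).filter fun p => p.1 + stepVec p.2 ∉ F

lemma mem_edgeBoundary {d : ℕ} {F : Finset (Fin d → ℤ)} {p : (Fin d → ℤ) × Dir d} :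
    p ∈ edgeBoundary F ↔ p.1 ∈ F ∧ p.1 + stepVec p.2 ∉ F := by
  simp [edgeBoundary]

/-- The number of boundary edges of `F` at the vertex `v`. -/
def bdDeg {d : ℕ} (F : Finset (Fin d → ℤ)) (v : Fin d → ℤ) : ℕ :=
  (Finset.univ.filter fun a : Dir d => ¬(v + stepVec a ∈ F ↔ v ∈ F)).card

lemma bdDeg_pos {d : ℕ} {F : Finset (Fin d → ℤ)} {v : Fin d → ℤ} :
    0 < bdDeg F v ↔ ∃ a : Dir d, ¬(v + stepVec a ∈ F ↔ v ∈ F) := by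
  simp [bdDeg, Finset.card_pos, Finset.filter_nonempty_iff]

lemma bdDeg_add_pos {d : ℕ} {F : Finset (Fin d → ℤ)} {v : Fin d → ℤ} {a : Dir d}
    (h : ¬(v + stepVec a ∈ F ↔ v ∈ F)) : 0 < bdDeg F (v + stepVec a) :=
  bdDeg_pos.2 ⟨a.opp, by rw [stepVec_opp, add_neg_cancel_right]; tauto⟩

/-- `bdDeg` sees a boundary edge from both ends, while `edgeBoundary` holds only its inner dart;
this is the factor `2`. -/
lemma sum_bdDeg_le {d : ℕ} (F W : Finset (Fin d → ℤ)) :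
    ∑ v ∈ W, bdDeg F v ≤ 2 * (edgeBoundary F).card := by
  classical
  rw [← Finset.sum_filter_add_sum_filter_not W (· ∈ F), two_mul]
  unfold bdDeg
  rw [← Finset.card_sigma, ← Finset.card_sigma]
  refine add_le_add ?_ ?_
  · refine Finset.card_le_card_of_injOn (fun s => (s.1, s.2)) ?_ ?_
    · rintro ⟨v, a⟩ h
      simp only [Finset.coe_sigma, Set.mem_sigma_iff, Finset.mem_coe, Finset.mem_filter] at h
      simp only [Finset.mem_coe, mem_edgeBoundary]
      tauto
    · rintro ⟨v, a⟩ _ ⟨v', a'⟩ _ h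
      simp only [Prod.mk.injEq] at h
      rw [h.1, h.2]
  · refine Finset.card_le_card_of_injOn (fun s => (s.1 + stepVec s.2, s.2.opp)) ?_ ?_
    · rintro ⟨v, a⟩ h
      simp only [Finset.coe_sigma, Set.mem_sigma_iff, Finset.mem_coe, Finset.mem_filter] at h
      simp only [Finset.mem_coe, mem_edgeBoundary, stepVec_opp, add_neg_cancel_right]
      tauto
    · rintro ⟨v, a⟩ _ ⟨v', a'⟩ _ h
      simp only [Prod.mk.injEq] at h
      have ha : a = a' := by rw [← a.opp_opp, h.2, a'.opp_opp]
      subst ha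
      rw [add_right_cancel h.1]

lemma card_le_of_bdDeg {d : ℕ} (F W : Finset (Fin d → ℤ)) (hW : ∀ v ∈ W, d ≤ 8 * bdDeg F v) :
    d * W.card ≤ 16 * (edgeBoundary F).card := by
  have h1 := sum_bdDeg_le F W
  have h2 : W.card * d ≤ ∑ v ∈ W, 8 * bdDeg F v := by
    rw [← smul_eq_mul]
    exact Finset.card_nsmul_le_sum _ _ _ hW
  rw [← Finset.mul_sum] at h2
  linarith [mul_comm W.card d]

/-- A finite set which is connected and has a connected complement. -/
def IsContour {d : ℕ} (F : Finset (Fin d → ℤ)) : Prop :=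
  ∀ x y, (x ∈ F ↔ y ∈ F) → (levelGraph (· ∈ F)).Reachable x y

lemma l1Dist_single_single {d : ℕ} (v : Fin d → ℤ) (i j : Fin d) :
    l1Dist (v + Pi.single i 1) (v + Pi.single j 1) ≤ 2 := by
  have h1 := l1Dist_add_stepVec v (i, true)
  have h2 := l1Dist_add_stepVec v (j, true)
  have h3 := l1Dist_triangle (v + Pi.single i 1) v (v + Pi.single j 1)
  simp only [stepVec, if_true] at h1 h2
  rw [l1Dist_comm (v + Pi.single i 1) v] at h3
  omega

open Classical in
-- A unit square has an even number of edges crossing a set. The hypotheses make all crossing edges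
-- of the square agree on `g`, so the crossing edges marked by `g` are even in number too.
lemma square_closed {m₀ m₁ m₂ m₃ g₀ g₁ g₂ : Prop}
    (h₁ : ¬(m₁ ↔ m₀) → (g₀ ↔ g₁)) (h₂ : ¬(m₂ ↔ m₀) → (g₀ ↔ g₂))
    (h₃ : ¬(m₃ ↔ m₁) → ¬(m₃ ↔ m₂) → (g₁ ↔ g₂))
    (h₄ : ¬(m₁ ↔ m₀) → ¬(m₃ ↔ m₂) → (g₀ ↔ g₂))
    (h₅ : ¬(m₂ ↔ m₀) → ¬(m₃ ↔ m₁) → (g₀ ↔ g₁)) :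
    ((if (m₁ ↔ m₀) then 0 else if g₀ then 1 else 0) +
      (if (m₃ ↔ m₁) then 0 else if g₁ then 1 else 0) : ZMod 2) =
    (if (m₂ ↔ m₀) then 0 else if g₀ then 1 else 0) +
      (if (m₃ ↔ m₂) then 0 else if g₂ then 1 else 0) := by
  have h11 : (1 : ZMod 2) + 1 = 0 := by decide
  by_cases m₀ <;> by_cases m₁ <;> by_cases m₂ <;> by_cases m₃ <;>
    by_cases g₀ <;> by_cases g₁ <;> by_cases g₂ <;> simp_all

/-- The boundary of a contour is connected through unit squares: a property of boundary vertices
which is shared by boundary vertices at distance at most `2` holds for all of them or for none. -/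
lemma IsContour.boundary_connected {d : ℕ} {F : Finset (Fin d → ℤ)} (hF : IsContour F)
    (g : (Fin d → ℤ) → Prop)
    (hg : ∀ u v, 0 < bdDeg F u → 0 < bdDeg F v → l1Dist u v ≤ 2 → g u → g v)
    {x y : Fin d → ℤ} (hx : 0 < bdDeg F x) (hy : 0 < bdDeg F y) (hgx : g x) : g y := by
  classical
  by_contra hgy
  have hg' : ∀ u v, 0 < bdDeg F u → 0 < bdDeg F v → l1Dist u v ≤ 2 → (g u ↔ g v) :=
    fun u v hu hv h => ⟨hg u v hu hv h, hg v u hv hu (l1Dist_comm u v ▸ h)⟩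
  -- `c` marks the boundary edges on which `g` holds; either endpoint may be tested, as both are
  -- boundary vertices at distance `1`. It is closed, hence has a potential `f`. Then `f` is
  -- constant on `F` and on its complement, yet jumps by `1` across a boundary edge at `x` and by
  -- `0` across one at `y`.
  let c : Fin d → (Fin d → ℤ) → ZMod 2 := fun i v =>
    if (v + Pi.single i 1 ∈ F ↔ v ∈ F) then 0 else if g v then 1 else 0
  have hpos : ∀ (v : Fin d → ℤ) (i : Fin d), ¬(v + Pi.single i 1 ∈ F ↔ v ∈ F) →
      0 < bdDeg F v ∧ 0 < bdDeg F (v + Pi.single i 1) := by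
    intro v i h
    exact ⟨bdDeg_pos.2 ⟨(i, true), h⟩, bdDeg_add_pos (a := (i, true)) h⟩
  have hstep : ∀ (v : Fin d → ℤ) (i : Fin d), l1Dist v (v + Pi.single i 1) ≤ 2 := fun v i =>
    (l1Dist_add_stepVec v (i, true)).le.trans (by norm_num)
  have hc : ∀ i j v, c i v + c j (v + Pi.single i 1) = c j v + c i (v + Pi.single j 1) := by
    intro i j v
    have e : v + Pi.single j 1 + Pi.single i 1 = v + Pi.single i 1 + Pi.single j 1 := by ring
    have p1 := hpos v i
    have p2 := hpos v j
    have p3 := hpos (v + Pi.single i 1) j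
    have p4 := hpos (v + Pi.single j 1) i
    have q1 := hg' v (v + Pi.single i 1)
    have q2 := hg' v (v + Pi.single j 1)
    have q3 := hg' (v + Pi.single i 1) (v + Pi.single j 1)
    simp only [hstep, l1Dist_single_single, true_implies] at q1 q2 q3
    simp only [c]
    rw [e] at p4 ⊢
    convert square_closed (m₀ := v ∈ F) (m₁ := v + Pi.single i 1 ∈ F) (m₂ := v + Pi.single j 1 ∈ F)
      (m₃ := v + Pi.single i 1 + Pi.single j 1 ∈ F) (g₀ := g v) (g₁ := g (v + Pi.single i 1))
      (g₂ := g (v + Pi.single j 1)) (fun h => q1 (p1 h).1 (p1 h).2) (fun h => q2 (p2 h).1 (p2 h).2)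
      (fun h h' => q3 (p3 h).1 (p4 h').1) (fun h h' => q2 (p1 h).1 (p4 h').1)
      (fun h h' => q1 (p2 h).1 (p3 h').1)
  obtain ⟨f, hf⟩ := exists_potential c hc
  have hfa : ∀ (v : Fin d → ℤ) (a : Dir d),
      f (v + stepVec a) = f v + if (v + stepVec a ∈ F ↔ v ∈ F) then 0 else if g v then 1 else 0 := by
    rintro v ⟨i, s⟩
    cases s with
    | true => exact hf i v
    | false =>
      have h := hf i (v + stepVec (i, false))
      have e : v + stepVec (i, false) + Pi.single i 1 = v := by
        simp [stepVec, Pi.single_neg]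
      have h2 : ∀ x : ZMod 2, x + x = 0 := by decide
      have p := hpos (v + stepVec (i, false)) i
      have q := hg' (v + stepVec (i, false)) v
      have hd := l1Dist_add_stepVec v (i, false)
      simp only [c] at h
      rw [e] at h p
      rw [h]
      by_cases hm : (v ∈ F ↔ v + stepVec (i, false) ∈ F)
      · simp [hm]
      · obtain ⟨p1, p2⟩ := p hm
        have q := q p1 p2 (by rw [l1Dist_comm]; omega)
        have hm' : ¬(v + stepVec (i, false) ∈ F ↔ v ∈ F) := fun h => hm h.symm
        rw [if_neg hm, if_neg hm']
        simp only [q]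
        rw [add_assoc, h2, add_zero]
  have hconst : ∀ u v, (u ∈ F ↔ v ∈ F) → f u = f v := by
    intro u v huv
    refine eq_of_reachable (reachable_of_reachable (hF u v huv) ?_)
    rintro u v - ⟨hadj, hm⟩
    obtain ⟨a, rfl⟩ := exists_stepVec_of_adj hadj
    have hm' : u + stepVec a ∈ F ↔ u ∈ F := by rw [eq_iff_iff] at hm; exact hm.symm
    rw [hfa, if_pos hm', add_zero]
  obtain ⟨a, ha⟩ := bdDeg_pos.1 hx
  obtain ⟨a', ha'⟩ := bdDeg_pos.1 hy
  have h1 := hfa x a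
  have h2 := hfa y a'
  rw [if_neg ha, if_pos hgx] at h1
  rw [if_neg ha', if_neg hgy, add_zero] at h2
  have h3 : f x = f (x + stepVec a) := by
    by_cases hxy : x ∈ F ↔ y ∈ F
    · rw [hconst x y hxy, ← h2]
      exact hconst _ _ (by tauto)
    · rw [hconst x (y + stepVec a') (by tauto), h2]
      exact hconst _ _ (by tauto)
  rw [← h3] at h1
  exact absurd (left_eq_add.1 h1) (by decide)

/-! ### Sparse cores of a boundary -/

/-- The number of opposite neighbours of `v` which have small boundary degree. -/
def mildDeg {d : ℕ} (F : Finset (Fin d → ℤ)) (v : Fin d → ℤ) : ℕ :=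
  (Finset.univ.filter fun a : Dir d =>
    ¬(v + stepVec a ∈ F ↔ v ∈ F) ∧ 8 * bdDeg F (v + stepVec a) < d).card

/-- The set of all neighbours of the members of `U`. -/
def nbhd {d : ℕ} (U : Finset (Fin d → ℤ)) : Finset (Fin d → ℤ) :=
  U.biUnion fun u => Finset.univ.image fun a : Dir d => u + stepVec a

lemma mem_nbhd {d : ℕ} {U : Finset (Fin d → ℤ)} {v : Fin d → ℤ} :
    v ∈ nbhd U ↔ ∃ u ∈ U, ∃ a : Dir d, u + stepVec a = v := by
  simp [nbhd]

lemma mildDeg_le_bdDeg {d : ℕ} (F : Finset (Fin d → ℤ)) (v : Fin d → ℤ) :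
    mildDeg F v ≤ bdDeg F v :=
  Finset.card_le_card fun a ha => by
    simp only [Finset.mem_filter] at ha ⊢
    exact ⟨ha.1, ha.2.1⟩

/-- Consider the squares spanned by a mild opposite direction `i` and some `a ∈ S`. If the edge from
`u + stepVec a` in direction `i` does not cross the boundary, then the edge from `u + stepVec i` in
direction `a` does; mildness allows this for fewer than `d / 8` of the at least `3 * d / 8` choices
of `a`. So each `i` yields at least `d / 4` boundary edges at the vertices `u + stepVec a`. -/
lemma mul_mildDeg_le {d : ℕ} {F : Finset (Fin d → ℤ)} {u : Fin d → ℤ} {S : Finset (Dir d)}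
    (hS : ∀ a ∈ S, (u + stepVec a ∈ F ↔ u ∈ F)) (hcard : 3 * d ≤ 8 * S.card) :
    d * mildDeg F u ≤ 4 * ∑ a ∈ S, bdDeg F (u + stepVec a) := by
  classical
  set P := Finset.univ.filter fun a : Dir d =>
    ¬(u + stepVec a ∈ F ↔ u ∈ F) ∧ 8 * bdDeg F (u + stepVec a) < d with hP
  have h1 : ∀ i ∈ P, d ≤ 4 * (S.filter fun a =>
      ¬(u + stepVec a + stepVec i ∈ F ↔ u + stepVec a ∈ F)).card := by
    intro i hi
    have hi' := (Finset.mem_filter.1 hi).2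
    have h2 : (S.filter fun a => (u + stepVec a + stepVec i ∈ F ↔ u + stepVec a ∈ F)).card ≤
        bdDeg F (u + stepVec i) := by
      refine Finset.card_le_card fun a ha => ?_
      obtain ⟨haS, ha⟩ := Finset.mem_filter.1 ha
      have := hS a haS
      have e : u + stepVec i + stepVec a = u + stepVec a + stepVec i := by ring
      simp only [Finset.mem_filter, Finset.mem_univ, true_and, e]
      tauto
    have h3 := Finset.card_filter_add_card_filter_not (s := S)
      fun a => (u + stepVec a + stepVec i ∈ F ↔ u + stepVec a ∈ F)
    omega
  have h4 : d * P.card ≤ ∑ i ∈ P, 4 * (S.filter fun a =>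
      ¬(u + stepVec a + stepVec i ∈ F ↔ u + stepVec a ∈ F)).card := by
    rw [mul_comm, ← smul_eq_mul]
    exact Finset.card_nsmul_le_sum _ _ _ h1
  have h5 : ∑ i ∈ P, (S.filter fun a =>
      ¬(u + stepVec a + stepVec i ∈ F ↔ u + stepVec a ∈ F)).card =
      ∑ a ∈ S, (P.filter fun i =>
      ¬(u + stepVec a + stepVec i ∈ F ↔ u + stepVec a ∈ F)).card :=
    Finset.sum_card_bipartiteAbove_eq_sum_card_bipartiteBelow
      (fun i a => ¬(u + stepVec a + stepVec i ∈ F ↔ u + stepVec a ∈ F))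
  rw [← Finset.mul_sum, h5] at h4
  refine h4.trans (Nat.mul_le_mul_left _ (Finset.sum_le_sum fun a _ => ?_))
  exact Finset.card_le_card fun i hi => by
    simp only [Finset.mem_filter, Finset.mem_univ, true_and] at hi ⊢
    exact hi.2

/-- The endpoints of the boundary edges of a finite set. -/
def boundaryVerts {d : ℕ} (F : Finset (Fin d → ℤ)) : Finset (Fin d → ℤ) :=
  (edgeBoundary F).image Prod.fst ∪ (edgeBoundary F).image fun p => p.1 + stepVec p.2

lemma mem_boundaryVerts {d : ℕ} {F : Finset (Fin d → ℤ)} {u : Fin d → ℤ} (hu : 0 < bdDeg F u) :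
    u ∈ boundaryVerts F := by
  obtain ⟨a, ha⟩ := bdDeg_pos.1 hu
  by_cases hm : u ∈ F
  · exact Finset.mem_union_left _ (Finset.mem_image.2 ⟨(u, a), by
      rw [mem_edgeBoundary]; simp only; tauto, rfl⟩)
  · exact Finset.mem_union_right _ (Finset.mem_image.2 ⟨(u + stepVec a, a.opp), by
      rw [mem_edgeBoundary]; simp only [stepVec_opp, add_neg_cancel_right]; tauto, by simp⟩)

/-- A sparse set of vertices whose neighbourhoods cover most of the flat part of the boundary. -/
lemma exists_cover {d : ℕ} (F : Finset (Fin d → ℤ)) :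
    ∃ U : Finset (Fin d → ℤ), (∀ u ∈ U, 8 * bdDeg F u < d ∧ 0 < mildDeg F u) ∧
      d * ∑ u ∈ U, mildDeg F u ≤ 8 * (edgeBoundary F).card ∧
      ∀ u, 8 * bdDeg F u < d → 0 < mildDeg F u →
        2 * (Finset.univ.filter fun a : Dir d => u + stepVec a ∉ nbhd U).card < d := by
  classical
  -- A maximal `U` satisfying `Q` works. A flat vertex with at least `d / 2` neighbours outside
  -- `nbhd U` has at least `d / 2 - d / 8 = 3 * d / 8` such neighbours on its own side, so
  -- `mul_mildDeg_le` lets it join `U` without violating `Q`.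
  let Q : Finset (Fin d → ℤ) → Prop := fun U => (∀ u ∈ U, 8 * bdDeg F u < d ∧ 0 < mildDeg F u) ∧
    d * ∑ u ∈ U, mildDeg F u ≤ 4 * ∑ p ∈ nbhd U, bdDeg F p
  obtain ⟨U, hU⟩ := ((boundaryVerts F).powerset.filter Q).exists_maximal ⟨∅, by simp [Q]⟩
  have hUQ : Q U := (Finset.mem_filter.1 hU.1).2
  have hUV : U ⊆ boundaryVerts F := Finset.mem_powerset.1 (Finset.mem_filter.1 hU.1).1
  refine ⟨U, hUQ.1, ?_, fun u hu hu' => ?_⟩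
  · have := sum_bdDeg_le F (nbhd U)
    have := hUQ.2
    omega
  by_contra! hcon
  let S : Finset (Dir d) := Finset.univ.filter fun a : Dir d =>
    u + stepVec a ∉ nbhd U ∧ (u + stepVec a ∈ F ↔ u ∈ F)
  have hSle : (Finset.univ.filter fun a : Dir d => u + stepVec a ∉ nbhd U).card ≤
      S.card + bdDeg F u := by
    refine (Finset.card_le_card (t := S ∪ _) fun a ha => ?_).trans (Finset.card_union_le _ _)
    simp only [S, Finset.mem_union, Finset.mem_filter, Finset.mem_univ, true_and] at ha ⊢
    tauto
  have hkey := mul_mildDeg_le (F := F) (u := u) (S := S) (fun a ha => (Finset.mem_filter.1 ha).2.2)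
    (by omega)
  have huU : u ∉ U := by
    intro h
    have : (Finset.univ.filter fun a : Dir d => u + stepVec a ∉ nbhd U) = ∅ := by
      refine Finset.filter_false_of_mem fun a _ => not_not.2 (mem_nbhd.2 ⟨u, h, a, rfl⟩)
    rw [this, Finset.card_empty] at hcon
    omega
  have hsub : nbhd U ∪ S.image (fun a => u + stepVec a) ⊆ nbhd (insert u U) := by
    intro p hp
    rcases Finset.mem_union.1 hp with hp | hp
    · obtain ⟨w, hw, a, rfl⟩ := mem_nbhd.1 hp
      exact mem_nbhd.2 ⟨w, Finset.mem_insert_of_mem hw, a, rfl⟩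
    · obtain ⟨a, -, rfl⟩ := Finset.mem_image.1 hp
      exact mem_nbhd.2 ⟨u, Finset.mem_insert_self _ _, a, rfl⟩
  have hdisj : Disjoint (nbhd U) (S.image fun a => u + stepVec a) := by
    rw [Finset.disjoint_right]
    intro p hp
    obtain ⟨a, ha, rfl⟩ := Finset.mem_image.1 hp
    exact (Finset.mem_filter.1 ha).2.1
  have hsum := Finset.sum_le_sum_of_subset (f := bdDeg F) hsub
  rw [Finset.sum_union hdisj, Finset.sum_image fun a _ b _ h =>
    stepVec_injective (add_left_cancel h)] at hsum
  have hV := mem_boundaryVerts (hu'.trans_le (mildDeg_le_bdDeg F u))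
  have hins : insert u U ∈ (boundaryVerts F).powerset.filter Q := by
    refine Finset.mem_filter.2 ⟨Finset.mem_powerset.2 (Finset.insert_subset hV hUV), ?_, ?_⟩
    · intro w hw
      rcases Finset.mem_insert.1 hw with rfl | hw
      · exact ⟨hu, hu'⟩
      · exact hUQ.1 w hw
    · rw [Finset.sum_insert huU, mul_add]
      have := hUQ.2
      omega
  exact huU (hU.2 hins (Finset.subset_insert _ _) (Finset.mem_insert_self _ _))

/-- A sparse set `D` of boundary vertices of `F`, with a subset `U`, such that `F` is determined
near its boundary by `U`, `D` and `F ∩ D`. -/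
structure IsCore {d : ℕ} (F U D : Finset (Fin d → ℤ)) : Prop where
  subset : U ⊆ D
  card_le : d * D.card ≤ 32 * (edgeBoundary F).card
  bdDeg_pos : ∀ v ∈ D, 0 < bdDeg F v
  lt_of_notMem : ∀ v ∉ D, 0 < bdDeg F v → 8 * bdDeg F v < d
  mem_iff : ∀ u ∈ U, ∀ a : Dir d, u + stepVec a ∉ D → (u + stepVec a ∈ F ↔ u ∈ F)
  cover : ∀ v ∉ D, ∀ a : Dir d, ¬(v + stepVec a ∈ F ↔ v ∈ F) → v + stepVec a ∉ D →
    2 * (Finset.univ.filter fun a : Dir d => v + stepVec a ∉ nbhd U).card < d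

/-- `D` consists of the cover `U`, the vertices `B` of boundary degree at least `d / 8`, and the
mild opposite neighbours `P` of `U`. With `b` boundary edges, `d * B.card` is at most `16 * b`, and
`d * U.card` and `d * P.card` at most `8 * b` each, whence the constant `32`. -/
lemma exists_isCore {d : ℕ} (hd : 0 < d) (F : Finset (Fin d → ℤ)) :
    ∃ U D : Finset (Fin d → ℤ), IsCore F U D := by
  classical
  obtain ⟨U, hU, hUcard, hcov⟩ := exists_cover F
  let B := (boundaryVerts F).filter fun v => d ≤ 8 * bdDeg F v
  let P := U.biUnion fun u => (Finset.univ.filter fun a : Dir d =>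
    ¬(u + stepVec a ∈ F ↔ u ∈ F) ∧ 8 * bdDeg F (u + stepVec a) < d).image fun a => u + stepVec a
  have hB : d * B.card ≤ 16 * (edgeBoundary F).card :=
    card_le_of_bdDeg F B fun v hv => (Finset.mem_filter.1 hv).2
  have hP : P.card ≤ ∑ u ∈ U, mildDeg F u :=
    Finset.card_biUnion_le.trans (Finset.sum_le_sum fun u _ => Finset.card_image_le)
  have hU' : U.card ≤ ∑ u ∈ U, mildDeg F u := by
    have := Finset.card_nsmul_le_sum U (mildDeg F) 1 fun u hu => (hU u hu).2
    simpa using this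
  have hmem : ∀ v, 0 < bdDeg F v → v ∉ U ∪ B ∪ P → 8 * bdDeg F v < d := by
    intro v hv hvD
    by_contra! hcon
    exact hvD (by 
      simp only [Finset.mem_union, B, Finset.mem_filter]
      exact .inl (.inr ⟨mem_boundaryVerts hv, hcon⟩))
  refine ⟨U, U ∪ B ∪ P, ?_, ?_, ?_, fun v h h' => hmem v h' h, ?_, ?_⟩
  · exact Finset.subset_union_left.trans Finset.subset_union_left
  · have h1 := Finset.card_union_le (U ∪ B) P
    have h2 := Finset.card_union_le U B
    have h3 := Nat.mul_le_mul_left d (h1.trans (Nat.add_le_add_right h2 _))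
    have h4 := Nat.mul_le_mul_left d hP
    have h5 := Nat.mul_le_mul_left d hU'
    rw [mul_add, mul_add] at h3
    omega
  · intro v hv
    simp only [Finset.mem_union] at hv
    rcases hv with (hv | hv) | hv
    · exact (hU v hv).2.trans_le (mildDeg_le_bdDeg F v)
    · have := (Finset.mem_filter.1 hv).2
      omega
    · obtain ⟨u, hu, hv⟩ := Finset.mem_biUnion.1 hv
      obtain ⟨a, ha, rfl⟩ := Finset.mem_image.1 hv
      exact bdDeg_add_pos (Finset.mem_filter.1 ha).2.1
  · intro u hu a ha
    by_contra hcon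
    have h8 := hmem _ (bdDeg_add_pos hcon) ha
    refine ha (Finset.mem_union_right _ (Finset.mem_biUnion.2 ⟨u, hu, Finset.mem_image.2 ⟨a, ?_, rfl⟩⟩))
    exact Finset.mem_filter.2 ⟨Finset.mem_univ _, hcon, h8⟩
  · intro v hv a ha hva
    have h1 := hmem _ (bdDeg_pos.2 ⟨a, ha⟩) hv
    have h2 := hmem _ (bdDeg_add_pos ha) hva
    refine hcov v h1 (Finset.card_pos.2 ⟨a, Finset.mem_filter.2 ⟨Finset.mem_univ _, ha, h2⟩⟩)

/-- The vertices whose status is determined by a core. -/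
def knownSet {d : ℕ} (U D : Finset (Fin d → ℤ)) : Set (Fin d → ℤ) :=
  {v | v ∈ D ∨ v ∈ nbhd U ∨ d ≤ (Finset.univ.filter fun a : Dir d => v + stepVec a ∈ nbhd U).card}

lemma card_dir (d : ℕ) : Fintype.card (Dir d) = 2 * d := by
  simp [Dir, mul_comm]

lemma card_filter_nbhd {d : ℕ} (U : Finset (Fin d → ℤ)) (v : Fin d → ℤ) :
    (Finset.univ.filter fun a : Dir d => v + stepVec a ∈ nbhd U).card +
    (Finset.univ.filter fun a : Dir d => v + stepVec a ∉ nbhd U).card = 2 * d := by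
  rw [Finset.card_filter_add_card_filter_not, Finset.card_univ, card_dir]

/-- Off `D`, a neighbour of `u ∈ U` lies on the side of `u`. A vertex off `D` with at least `d`
neighbours in `nbhd U` follows their majority: were `F` and `F'` to disagree at it, each of those
neighbours would be opposite for one of the two, but each set allows fewer than `d / 8` opposite
neighbours. -/
lemma IsCore.mem_iff_mem {d : ℕ} (hd : 0 < d) {F F' U D : Finset (Fin d → ℤ)} (h : IsCore F U D)
    (h' : IsCore F' U D) (hD : ∀ v ∈ D, (v ∈ F ↔ v ∈ F')) {v : Fin d → ℤ}
    (hv : v ∈ knownSet U D) : v ∈ F ↔ v ∈ F' := by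
  have hN : ∀ v ∈ nbhd U, (v ∈ F ↔ v ∈ F') := by
    intro v hv
    by_cases hvD : v ∈ D
    · exact hD v hvD
    obtain ⟨u, hu, a, rfl⟩ := mem_nbhd.1 hv
    rw [h.mem_iff u hu a hvD, h'.mem_iff u hu a hvD]
    exact hD u (h.subset hu)
  by_cases hvD : v ∈ D
  · exact hD v hvD
  rcases hv with hv | hv | hv
  · exact absurd hv hvD
  · exact hN v hv
  · have h1 : 8 * bdDeg F v < d := by
      rcases Nat.eq_zero_or_pos (bdDeg F v) with h0 | h0
      · omega
      · exact h.lt_of_notMem v hvD h0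
    have h2 : 8 * bdDeg F' v < d := by
      rcases Nat.eq_zero_or_pos (bdDeg F' v) with h0 | h0
      · omega
      · exact h'.lt_of_notMem v hvD h0
    by_contra hcon
    have hsub : (Finset.univ.filter fun a : Dir d => v + stepVec a ∈ nbhd U) ⊆
        (Finset.univ.filter fun a : Dir d => ¬(v + stepVec a ∈ F ↔ v ∈ F)) ∪
        (Finset.univ.filter fun a : Dir d => ¬(v + stepVec a ∈ F' ↔ v ∈ F')) := by
      intro a ha
      have := hN _ (Finset.mem_filter.1 ha).2
      simp only [Finset.mem_union, Finset.mem_filter, Finset.mem_univ, true_and]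
      tauto
    have h3 := (Finset.card_le_card hsub).trans (Finset.card_union_le _ _)
    unfold bdDeg at h1 h2
    omega

/-- No boundary edge joins two unknown vertices: by `cover`, an end of such an edge would have more
than `3 * d / 2` neighbours in `nbhd U` and so be known. -/
lemma IsCore.mem_iff_of_notMem {d : ℕ} {F U D : Finset (Fin d → ℤ)} (h : IsCore F U D)
    {v : Fin d → ℤ} {a : Dir d} (hv : v ∉ knownSet U D) (hva : v + stepVec a ∉ knownSet U D) :
    v + stepVec a ∈ F ↔ v ∈ F := by
  by_contra hcon
  simp only [knownSet, Set.mem_ofPred_eq, not_or, not_le] at hv hva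
  have h1 := h.cover v hv.1 a hcon hva.1
  have h2 := card_filter_nbhd U v
  omega

lemma exists_near_of_mem_nbhd {d : ℕ} {U D : Finset (Fin d → ℤ)} (hUD : U ⊆ D)
    {v : Fin d → ℤ} (h : 0 < (Finset.univ.filter fun a : Dir d => v + stepVec a ∈ nbhd U).card) :
    ∃ x ∈ D, l1Dist v x ≤ 2 := by
  obtain ⟨a, ha⟩ := Finset.card_pos.1 h
  obtain ⟨u, hu, a', hua⟩ := mem_nbhd.1 (Finset.mem_filter.1 ha).2
  refine ⟨u, hUD hu, ?_⟩
  have h1 := l1Dist_add_stepVec v a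
  have h2 := l1Dist_add_stepVec u a'
  have h3 := l1Dist_triangle v (v + stepVec a) u
  rw [hua, l1Dist_comm] at h2
  omega

lemma exists_near_of_mem_knownSet {d : ℕ} (hd : 0 < d) {U D : Finset (Fin d → ℤ)} (hUD : U ⊆ D)
    {v : Fin d → ℤ} (hv : v ∈ knownSet U D) : ∃ x ∈ D, l1Dist v x ≤ 2 := by
  rcases hv with hv | hv | hv
  · exact ⟨v, hv, by simp [l1Dist_self]⟩
  · obtain ⟨u, hu, a, rfl⟩ := mem_nbhd.1 hv
    exact ⟨u, hUD hu, by rw [l1Dist_comm, l1Dist_add_stepVec]; norm_num⟩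
  · exact exists_near_of_mem_nbhd hUD (by omega)

lemma IsCore.exists_near {d : ℕ} {F U D : Finset (Fin d → ℤ)} (h : IsCore F U D)
    {v : Fin d → ℤ} (hv : 0 < bdDeg F v) : ∃ x ∈ D, l1Dist v x ≤ 2 := by
  by_cases hvD : v ∈ D
  · exact ⟨v, hvD, by simp [l1Dist_self]⟩
  obtain ⟨a, ha⟩ := LatticeShift.bdDeg_pos.1 hv
  by_cases hva : v + stepVec a ∈ D
  · exact ⟨_, hva, by rw [l1Dist_add_stepVec]; norm_num⟩
  have h1 := h.cover v hvD a ha hva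
  have h2 := card_filter_nbhd U v
  exact exists_near_of_mem_nbhd h.subset (by omega)

/-- Every boundary vertex is within `2` of `D`, and the boundary is connected by jumps of length at
most `2`; hence the scale `6 = 2 + 2 + 2`. -/
lemma IsCore.connected {d : ℕ} {F U D : Finset (Fin d → ℤ)} (h : IsCore F U D)
    (hF : IsContour F) {S : Finset (Fin d → ℤ)} (hSD : S ⊆ D) (hS : S.Nonempty) (hne : S ≠ D) :
    ∃ x ∈ S, ∃ y ∈ D, y ∉ S ∧ l1Dist x y ≤ 6 := by
  by_contra! hcon
  obtain ⟨y, hyD, hyS⟩ := Finset.exists_of_ssubset (hSD.ssubset_of_ne hne)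
  obtain ⟨x, hx⟩ := hS
  have hg : ∀ u v, 0 < bdDeg F u → 0 < bdDeg F v → l1Dist u v ≤ 2 →
      (∃ x ∈ S, l1Dist u x ≤ 2) → ∃ x ∈ S, l1Dist v x ≤ 2 := by
    rintro u v _ hv huv ⟨x, hx, hux⟩
    obtain ⟨y, hy, hvy⟩ := h.exists_near hv
    refine ⟨y, ?_, hvy⟩
    by_contra hyS
    have h1 := hcon x hx y hy hyS
    have h2 := l1Dist_triangle x u y
    have h3 := l1Dist_triangle u v y
    rw [l1Dist_comm x u] at h2
    omega
  obtain ⟨z, hz, hyz⟩ := hF.boundary_connected (fun v => ∃ x ∈ S, l1Dist v x ≤ 2) hg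
    (h.bdDeg_pos x (hSD hx)) (h.bdDeg_pos y hyD) ⟨x, hx, by simp [l1Dist_self]⟩
  have h1 := hcon z hz y hyD hyS
  rw [l1Dist_comm] at h1
  omega

/-! ### Extremal points and the undetermined components -/

open Classical in
/-- An extremal point of a finite set in the direction `a`. -/
noncomputable def exitPoint {d : ℕ} (a : Dir d) (Z : Finset (Fin d → ℤ)) : Fin d → ℤ :=
  if h : Z.Nonempty then (exists_exit Z.finite_toSet (Finset.coe_nonempty.2 h) a).choose else 0

lemma exitPoint_spec {d : ℕ} (a : Dir d) {Z : Finset (Fin d → ℤ)} (h : Z.Nonempty) :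
    exitPoint a Z ∈ Z ∧ exitPoint a Z + stepVec a ∉ Z ∧
      ∀ y ∈ Z, (if a.2 then y a.1 else -y a.1) ≤
        (if a.2 then exitPoint a Z a.1 else -exitPoint a Z a.1) := by
  unfold exitPoint
  rw [dif_pos h]
  have := (exists_exit Z.finite_toSet (Finset.coe_nonempty.2 h) a).choose_spec
  simpa using this

/-- A finite set is exited at least once in each of the `2 * d` directions. -/
lemma two_mul_le_card_edgeBoundary {d : ℕ} {Z : Finset (Fin d → ℤ)} (h : Z.Nonempty) :
    2 * d ≤ (edgeBoundary Z).card := by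
  rw [← card_dir, ← Finset.card_univ]
  refine Finset.card_le_card_of_injOn (fun a => (exitPoint a Z, a)) ?_ ?_
  · intro a _
    exact mem_edgeBoundary.2 ⟨(exitPoint_spec a h).1, (exitPoint_spec a h).2.1⟩
  · intro a _ b _ hab
    exact (Prod.mk.inj hab).2

/-- Most of the boundary edges of `Z` are boundary edges of `F`. -/
def IsBad {d : ℕ} (F Z : Finset (Fin d → ℤ)) : Prop :=
  (edgeBoundary Z).card ≤
    2 * ((edgeBoundary Z).filter fun p => ¬(p.1 + stepVec p.2 ∈ F ↔ p.1 ∈ F)).card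

/-- The marked points of the bad finite components of the complement of `K`. -/
def badPoints {d : ℕ} (a : Dir d) (K : Set (Fin d → ℤ)) (F : Finset (Fin d → ℤ)) :
    Set (Fin d → ℤ) :=
  {x | x ∉ K ∧ ∃ Z : Finset (Fin d → ℤ), (∀ y, y ∈ Z ↔ (levelGraph (· ∈ K)).Reachable x y) ∧
    x = exitPoint a Z ∧ IsBad F Z}

/-- The marked components are disjoint. Each has at least `2 * d` boundary edges, at least half of
them boundary edges of `F`, so each uses up `d` units of boundary degree. -/
lemma card_le_of_subset_badPoints {d : ℕ} (a : Dir d) (K : Set (Fin d → ℤ))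
    (F E : Finset (Fin d → ℤ)) (hE : ∀ x ∈ E, x ∈ badPoints a K F) :
    d * E.card ≤ 2 * (edgeBoundary F).card := by
  classical
  choose! Z hZ using fun x hx => (hE x hx).2
  have h1 : ∀ x ∈ E, d ≤ ∑ p ∈ Z x, bdDeg F p := by
    intro x hx
    obtain ⟨hZx, -, hbad⟩ := hZ x hx
    have h2 := two_mul_le_card_edgeBoundary ⟨x, (hZx x).2 (.refl _)⟩
    have h3 : ((edgeBoundary (Z x)).filter fun p => ¬(p.1 + stepVec p.2 ∈ F ↔ p.1 ∈ F)).card ≤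
        ∑ p ∈ Z x, bdDeg F p := by
      unfold bdDeg
      rw [← Finset.card_sigma]
      refine Finset.card_le_card_of_injOn (fun p => ⟨p.1, p.2⟩) ?_ ?_
      · intro p hp
        obtain ⟨hp1, hp2⟩ := Finset.mem_filter.1 hp
        simp only [Finset.coe_sigma, Set.mem_sigma_iff, Finset.mem_coe, Finset.mem_filter,
          Finset.mem_univ, true_and]
        exact ⟨(mem_edgeBoundary.1 hp1).1, hp2⟩
      · rintro ⟨p, b⟩ _ ⟨q, c⟩ _ h
        simpa using h
    unfold IsBad at hbad
    omega
  have hdisj : (E : Set (Fin d → ℤ)).PairwiseDisjoint Z := by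
    intro x hx y hy hxy
    rw [Function.onFun, Finset.disjoint_left]
    intro z hzx hzy
    have hxz := ((hZ x hx).1 z).1 hzx
    have hyz := ((hZ y hy).1 z).1 hzy
    have hZe : Z x = Z y := by
      ext w
      rw [(hZ x hx).1, (hZ y hy).1]
      exact ⟨fun h => hyz.trans (hxz.symm.trans h), fun h => hxz.trans (hyz.symm.trans h)⟩
    exact hxy ((hZ x hx).2.1.trans (hZe ▸ (hZ y hy).2.1.symm))
  calc d * E.card = E.card • d := by rw [smul_eq_mul, mul_comm]
    _ ≤ ∑ x ∈ E, ∑ p ∈ Z x, bdDeg F p := Finset.card_nsmul_le_sum _ _ _ h1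
    _ = ∑ p ∈ E.biUnion Z, bdDeg F p := (Finset.sum_biUnion hdisj).symm
    _ ≤ _ := sum_bdDeg_le _ _

lemma finite_badPoints {d : ℕ} (a : Dir d) (K : Set (Fin d → ℤ)) (F : Finset (Fin d → ℤ)) :
    (badPoints a K F).Finite := by
  by_contra hinf
  obtain ⟨E, hE, hcard⟩ := Set.Infinite.exists_subset_card_eq hinf (2 * (edgeBoundary F).card + 1)
  have h := card_le_of_subset_badPoints a K F E fun x hx => hE hx
  have hd : 0 < d := a.1.pos
  have := Nat.le_mul_of_pos_left E.card hd
  omega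

lemma exists_near_of_mem_badPoints {d : ℕ} {a : Dir d} {U D F : Finset (Fin d → ℤ)} (hUD : U ⊆ D)
    {x : Fin d → ℤ} (hx : x ∈ badPoints a (knownSet U D) F) : ∃ y ∈ D, l1Dist x y ≤ 3 := by
  obtain ⟨hxK, Z, hZ, hxZ, -⟩ := hx
  have hxZ' : x ∈ Z := (hZ x).2 (.refl _)
  have hspec := exitPoint_spec a ⟨x, hxZ'⟩
  rw [← hxZ] at hspec
  have hK : x + stepVec a ∈ knownSet U D := by
    by_contra hK
    exact hspec.2.1 ((hZ _).2 (levelGraph_adj_add (by simp [hxK, hK])).reachable)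
  obtain ⟨y, hy, hxy⟩ := exists_near_of_mem_knownSet a.1.pos hUD hK
  have h1 := l1Dist_add_stepVec x a
  have h2 := l1Dist_triangle x (x + stepVec a) y
  exact ⟨y, hy, by omega⟩

lemma IsCore.mem_iff_of_reachable {d : ℕ} {F U D : Finset (Fin d → ℤ)} (h : IsCore F U D)
    {z x : Fin d → ℤ} (hz : z ∉ knownSet U D)
    (hx : (levelGraph (· ∈ knownSet U D)).Reachable z x) : x ∈ F ↔ z ∈ F := by
  have : (z ∈ F) = (x ∈ F) := by
    refine eq_of_reachable (φ := (· ∈ F)) (reachable_of_reachable hx ?_)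
    rintro u v hu ⟨hadj, huv⟩
    obtain ⟨a, rfl⟩ := exists_stepVec_of_adj hadj
    have hu' : u ∉ knownSet U D := by rw [← eq_of_reachable hu]; exact hz
    have hv' : u + stepVec a ∉ knownSet U D := fun hv => hu' (huv.mpr hv)
    exact eq_iff_iff.2 (h.mem_iff_of_notMem hu' hv').symm
  rw [← eq_iff_iff, this]

/-- A finite set is determined by a core, its bad points, and its intersection with these. -/
lemma IsCore.eq_of_badPoints {d : ℕ} (a : Dir d) {F F' U D : Finset (Fin d → ℤ)}
    (h : IsCore F U D) (h' : IsCore F' U D)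
    (hE : badPoints a (knownSet U D) F = badPoints a (knownSet U D) F')
    (hD : ∀ v ∈ D, (v ∈ F ↔ v ∈ F'))
    (hb : ∀ v ∈ badPoints a (knownSet U D) F, (v ∈ F ↔ v ∈ F')) : F = F' := by
  classical
  ext z
  by_cases hz : z ∈ knownSet U D
  · exact h.mem_iff_mem a.1.pos h' hD hz
  by_contra hcon
  -- The whole component of `z` lies in one of `F` and `F'`, and both are finite.
  have hfin : {y | (levelGraph (· ∈ knownSet U D)).Reachable z y}.Finite := by
    by_cases hzF : z ∈ F
    · exact F.finite_toSet.subset fun y hy => (h.mem_iff_of_reachable hz hy).2 hzF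
    · exact F'.finite_toSet.subset fun y hy => (h'.mem_iff_of_reachable hz hy).2 (by tauto)
  set Z := hfin.toFinset with hZdef
  have hZ : ∀ y, y ∈ Z ↔ (levelGraph (· ∈ knownSet U D)).Reachable z y := by simp [hZdef]
  have hne : ∀ y ∈ Z, ¬(y ∈ F ↔ y ∈ F') := by
    intro y hy
    rw [h.mem_iff_of_reachable hz ((hZ y).1 hy), h'.mem_iff_of_reachable hz ((hZ y).1 hy)]
    exact hcon
  have hxZ := (exitPoint_spec a ⟨z, (hZ z).2 (.refl _)⟩).1
  have hzx := (hZ _).1 hxZ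
  have hbad : ∀ G : Finset (Fin d → ℤ), IsBad G Z →
      exitPoint a Z ∈ badPoints a (knownSet U D) G := by
    refine fun G hG => ⟨?_, Z, fun y => ?_, rfl, hG⟩
    · rw [← eq_of_reachable hzx]; exact hz
    · rw [hZ]
      exact ⟨fun h => hzx.symm.trans h, fun h => hzx.trans h⟩
  refine hne _ hxZ (hb _ ?_)
  -- The sets differ on `Z` but agree just outside it, so every boundary edge of `Z` is a boundary
  -- edge of `F` or of `F'`. Hence `Z` is bad for at least one of them, and its mark is in the
  -- common set of bad points, where `F` and `F'` agree.
  have hcount : (edgeBoundary Z).card ≤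
      ((edgeBoundary Z).filter fun p => ¬(p.1 + stepVec p.2 ∈ F ↔ p.1 ∈ F)).card +
      ((edgeBoundary Z).filter fun p => ¬(p.1 + stepVec p.2 ∈ F' ↔ p.1 ∈ F')).card := by
    refine (Finset.card_le_card fun p hp => ?_).trans (Finset.card_union_le _ _)
    obtain ⟨hp1, hp2⟩ := mem_edgeBoundary.1 hp
    have hpK : p.1 ∉ knownSet U D := by rw [← eq_of_reachable ((hZ _).1 hp1)]; exact hz
    have hpK' : p.1 + stepVec p.2 ∈ knownSet U D := by
      by_contra hK
      exact hp2 ((hZ _).2 (((hZ _).1 hp1).trans (levelGraph_adj_add (by simp [hpK, hK])).reachable))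
    have h1 := h.mem_iff_mem a.1.pos h' hD hpK'
    have h2 := hne _ hp1
    simp only [Finset.mem_union, Finset.mem_filter, hp, true_and]
    tauto
  by_cases hF : IsBad F Z
  · exact hbad F hF
  · rw [hE]
    refine hbad F' ?_
    unfold IsBad at hF ⊢
    omega

/-! ### Lattice walks and the number of contours -/

/-- The end point of the lattice walk from `r` with given steps. -/
def walkEnd {d : ℕ} (r : Fin d → ℤ) (w : List (Dir d)) : Fin d → ℤ := r + (w.map stepVec).sum

/-- The vertices visited by the lattice walk from `r` with given steps. -/
def visited {d : ℕ} (r : Fin d → ℤ) (w : List (Dir d)) : Finset (Fin d → ℤ) :=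
  (Finset.range (w.length + 1)).image fun k => walkEnd r (w.take k)

lemma card_visited_le {d : ℕ} (r : Fin d → ℤ) (w : List (Dir d)) :
    (visited r w).card ≤ w.length + 1 :=
  Finset.card_image_le.trans (by simp)

lemma walkEnd_append {d : ℕ} (r : Fin d → ℤ) (w₁ w₂ : List (Dir d)) :
    walkEnd r (w₁ ++ w₂) = walkEnd (walkEnd r w₁) w₂ := by
  simp [walkEnd, add_assoc]

lemma mem_visited {d : ℕ} {r x : Fin d → ℤ} {w : List (Dir d)} :
    x ∈ visited r w ↔ ∃ w₁ w₂, w = w₁ ++ w₂ ∧ walkEnd r w₁ = x := by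
  simp only [visited, Finset.mem_image, Finset.mem_range]
  constructor
  · rintro ⟨k, -, rfl⟩
    exact ⟨_, _, (List.take_append_drop k w).symm, rfl⟩
  · rintro ⟨w₁, w₂, rfl, rfl⟩
    exact ⟨w₁.length, by simp, by simp⟩

lemma visited_append {d : ℕ} (r : Fin d → ℤ) (w₁ w₂ : List (Dir d)) :
    visited r (w₁ ++ w₂) = visited r w₁ ∪ visited (walkEnd r w₁) w₂ := by
  ext x
  simp only [Finset.mem_union, mem_visited]
  constructor
  · rintro ⟨u₁, u₂, h, rfl⟩
    rcases List.append_eq_append_iff.1 h with ⟨v, h1, h2⟩ | ⟨v, h1, h2⟩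
    · exact .inr ⟨v, u₂, h2, by rw [h1, walkEnd_append]⟩
    · exact .inl ⟨u₁, v, h1, rfl⟩
  · rintro (⟨u₁, u₂, rfl, rfl⟩ | ⟨u₁, u₂, rfl, rfl⟩)
    · exact ⟨u₁, u₂ ++ w₂, by simp, rfl⟩
    · exact ⟨w₁ ++ u₁, u₂, by simp, by rw [walkEnd_append]⟩

lemma walkEnd_mem_visited {d : ℕ} (r : Fin d → ℤ) (w : List (Dir d)) :
    walkEnd r w ∈ visited r w := mem_visited.2 ⟨w, [], by simp, rfl⟩

lemma exists_walk {d : ℕ} (u v : Fin d → ℤ) :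
    ∃ w : List (Dir d), w.length = l1Dist u v ∧ walkEnd u w = v := by
  generalize hn : l1Dist u v = n
  induction n generalizing u with
  | zero => exact ⟨[], rfl, by simp [walkEnd, eq_of_l1Dist_eq_zero hn]⟩
  | succ n ih =>
    obtain ⟨a, -, ha⟩ := exists_stepVec_of_lt hn
    obtain ⟨w, hw, he⟩ := ih _ ha
    exact ⟨a :: w, by simp [hw], by rw [← he]; simp [walkEnd, add_assoc]⟩

lemma exists_detour {d : ℕ} {r x y : Fin d → ℤ} {w : List (Dir d)} {s : ℕ} (hx : x ∈ visited r w)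
    (hxy : l1Dist x y ≤ s) : ∃ w' : List (Dir d), w'.length ≤ w.length + 2 * s ∧
      visited r w ⊆ visited r w' ∧ y ∈ visited r w' := by
  obtain ⟨w₁, w₂, rfl, rfl⟩ := mem_visited.1 hx
  obtain ⟨p, hp, hpe⟩ := exists_walk (walkEnd r w₁) y
  obtain ⟨q, hq, hqe⟩ := exists_walk y (walkEnd r w₁)
  rw [l1Dist_comm] at hq
  refine ⟨w₁ ++ (p ++ (q ++ w₂)), by simp; omega, ?_, ?_⟩
  · simp only [visited_append, hpe, hqe]
    intro z hz
    simp only [Finset.mem_union] at hz ⊢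
    tauto
  · simp only [visited_append, Finset.mem_union]
    right; left
    exact hpe ▸ walkEnd_mem_visited _ p

/-- A finite set which is connected at scale `s` is visited by a short lattice walk. -/
lemma exists_walk_visiting {d s : ℕ} {r x₀ : Fin d → ℤ} {w₀ : List (Dir d)}
    (hx₀ : x₀ ∈ visited r w₀) {D : Finset (Fin d → ℤ)} (hxD : x₀ ∈ D)
    (hD : ∀ S ⊆ D, S.Nonempty → S ≠ D → ∃ x ∈ S, ∃ y ∈ D, y ∉ S ∧ l1Dist x y ≤ s) :
    ∃ w : List (Dir d), w.length ≤ w₀.length + 2 * s * D.card ∧ D ⊆ visited r w := by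
  -- Points are added one at a time, each by a round trip of length at most `2 * s` from a point
  -- already visited.
  have key : ∀ k, k + 1 ≤ D.card → ∃ S ⊆ D, S.card = k + 1 ∧ ∃ w : List (Dir d),
      w.length ≤ w₀.length + 2 * s * k ∧ S ⊆ visited r w := by
    intro k
    induction k with
    | zero => exact fun _ => ⟨{x₀}, by simpa using hxD, by simp, w₀, by simp, by simpa using hx₀⟩
    | succ k ih =>
      intro hk
      obtain ⟨S, hSD, hS, w, hw, hSw⟩ := ih (by omega)
      obtain ⟨x, hx, y, hy, hyS, hxy⟩ := hD S hSD (Finset.card_pos.1 (by omega))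
        (by rintro rfl; omega)
      obtain ⟨w', hw', hsub, hyw⟩ := exists_detour (hSw hx) hxy
      refine ⟨insert y S, Finset.insert_subset hy hSD, by rw [Finset.card_insert_of_notMem hyS, hS],
        w', ?_, Finset.insert_subset hyw (hSw.trans hsub)⟩
      rw [mul_add]
      omega
  have hpos := Finset.card_pos.2 ⟨x₀, hxD⟩
  obtain ⟨S, hSD, hS, w, hw, hSw⟩ := key (D.card - 1) (by omega)
  have : S = D := Finset.eq_of_subset_of_card_le hSD (by omega)
  subst this
  exact ⟨w, hw.trans (by gcongr; omega), hSw⟩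

/-- Go straight from `r` until the last point before leaving `F`. Every coordinate slice passed is
non-empty, so it contributes a boundary edge in each of the `2 * (d - 1) ≥ d` transverse directions;
this bounds the number of steps. -/
lemma exists_ray_exit {d : ℕ} (hd : 2 ≤ d) {F : Finset (Fin d → ℤ)} {r : Fin d → ℤ} (hr : r ∈ F) :
    ∃ w : List (Dir d), d * w.length ≤ (edgeBoundary F).card ∧ 0 < bdDeg F (walkEnd r w) := by
  classical
  let a : Dir d := (⟨0, by omega⟩, true)
  have hcoord : ∀ t : ℕ, walkEnd r (List.replicate t a) a.1 = r a.1 + t := by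
    intro t
    simp [walkEnd, List.sum_replicate, stepVec, a]
  have hsucc : ∀ t : ℕ, walkEnd r (List.replicate (t + 1) a) =
      walkEnd r (List.replicate t a) + stepVec a := by
    intro t
    rw [List.replicate_succ', walkEnd_append]
    simp [walkEnd]
  have hex : ∃ t : ℕ, walkEnd r (List.replicate (t + 1) a) ∉ F := by
    by_contra! hcon
    refine Set.infinite_of_injective_forall_mem (f := fun t : ℕ => walkEnd r (List.replicate (t + 1) a))
      ?_ hcon F.finite_toSet
    intro s t hst
    have := congrFun hst a.1
    simp only [hcoord] at this
    push_cast at this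
    omega
  let t := Nat.find hex
  have ht : walkEnd r (List.replicate (t + 1) a) ∉ F := Nat.find_spec hex
  have hlt : ∀ s ≤ t, walkEnd r (List.replicate s a) ∈ F := by
    intro s hs
    cases s with
    | zero => simpa [walkEnd] using hr
    | succ s => exact not_not.1 (Nat.find_min hex (by omega))
  refine ⟨List.replicate t a, ?_, bdDeg_pos.2 ⟨a, ?_⟩⟩
  · let Z : ℕ → Finset (Fin d → ℤ) := fun s => F.filter fun x => x a.1 = r a.1 + s
    have hZ : ∀ s ≤ t, (Z s).Nonempty := fun s hs =>
      ⟨_, Finset.mem_filter.2 ⟨hlt s hs, hcoord s⟩⟩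
    let A : Finset (Dir d) := Finset.univ.filter fun b => b.1 ≠ a.1
    have hA : d ≤ A.card := by
      have h1 : (Finset.univ.filter fun i : Fin d => i ≠ a.1) ×ˢ (Finset.univ : Finset Bool) = A := by
        ext b; simp [A]
      rw [← h1, Finset.card_product, Finset.filter_ne' , Finset.card_erase_of_mem (Finset.mem_univ _)]
      simp
      omega
    have hinj : (Finset.range (t + 1) ×ˢ A).card ≤ (edgeBoundary F).card := by
      refine Finset.card_le_card_of_injOn (fun p => (exitPoint p.2 (Z p.1), p.2)) ?_ ?_
      · rintro ⟨s, b⟩ h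
        simp only [Finset.coe_product, Set.mem_prod, Finset.mem_coe, Finset.mem_range] at h
        obtain ⟨h1, h2, -⟩ := exitPoint_spec b (hZ s (by omega))
        obtain ⟨h3, h4⟩ := Finset.mem_filter.1 h1
        refine mem_edgeBoundary.2 ⟨h3, fun h5 => h2 (Finset.mem_filter.2 ⟨h5, ?_⟩)⟩
        have hb : a.1 ≠ b.1 := (Finset.mem_filter.1 h.2).2.symm
        rw [← h4]
        simp [stepVec, hb]
      · rintro ⟨s, b⟩ h ⟨s', b'⟩ h' heq
        simp only [Finset.coe_product, Set.mem_prod, Finset.mem_coe, Finset.mem_range] at h h'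
        obtain ⟨h1, h2⟩ := Prod.mk.inj heq
        simp only at h1 h2
        subst h2
        have h3 := (Finset.mem_filter.1 (exitPoint_spec b (hZ s (by omega))).1).2
        have h4 := (Finset.mem_filter.1 (exitPoint_spec b (hZ s' (by omega))).1).2
        rw [h1, h4] at h3
        simp only [Prod.mk.injEq, and_true]
        omega
    rw [Finset.card_product, Finset.card_range] at hinj
    rw [List.length_replicate]
    nlinarith
  · rw [← hsucc]
    simp [ht, hlt t le_rfl]

/-- Every contour through `r` is encoded near a short lattice walk from `r`. -/
lemma IsContour.exists_code {d : ℕ} (hd : 2 ≤ d) {F : Finset (Fin d → ℤ)} (hF : IsContour F)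
    {r : Fin d → ℤ} (hr : r ∈ F) :
    ∃ (w : List (Dir d)) (U D E : Finset (Fin d → ℤ)), d * w.length ≤ 410 * (edgeBoundary F).card ∧
      IsCore F U D ∧ (∀ x, x ∈ E ↔ x ∈ badPoints (⟨0, by omega⟩, true) (knownSet U D) F) ∧
      D ∪ E ⊆ visited r w := by
  classical
  obtain ⟨U, D, h⟩ := exists_isCore (by omega) F
  set a : Dir d := (⟨0, by omega⟩, true)
  let E := (finite_badPoints a (knownSet U D) F).toFinset
  have hE : ∀ x, x ∈ E ↔ x ∈ badPoints a (knownSet U D) F := by simp [E]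
  obtain ⟨w₀, hw₀, hpos⟩ := exists_ray_exit hd hr
  obtain ⟨x₀, hx₀, hdist⟩ := h.exists_near hpos
  obtain ⟨p, hp, hpe⟩ := exists_walk (walkEnd r w₀) x₀
  have hvis : x₀ ∈ visited r (w₀ ++ p) := by
    rw [← hpe, ← walkEnd_append]
    exact walkEnd_mem_visited _ _
  have hconn : ∀ S ⊆ D ∪ E, S.Nonempty → S ≠ D ∪ E →
      ∃ x ∈ S, ∃ y ∈ D ∪ E, y ∉ S ∧ l1Dist x y ≤ 6 := by
    intro S hS hne hneq
    by_cases h1 : (S ∩ D).Nonempty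
    · by_cases h2 : S ∩ D = D
      · obtain ⟨y, hy, hyS⟩ := Finset.exists_of_ssubset (hS.ssubset_of_ne hneq)
        have hDS : D ⊆ S := Finset.inter_eq_right.1 h2
        have hyE : y ∈ E := (Finset.mem_union.1 hy).resolve_left fun h => hyS (hDS h)
        obtain ⟨x, hx, hxy⟩ := exists_near_of_mem_badPoints h.subset ((hE y).1 hyE)
        exact ⟨x, hDS hx, y, hy, hyS, by rw [l1Dist_comm]; omega⟩
      · obtain ⟨x, hx, y, hy, hyS, hxy⟩ := h.connected hF Finset.inter_subset_right h1 h2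
        exact ⟨x, (Finset.mem_inter.1 hx).1, y, Finset.mem_union_left _ hy,
          fun h => hyS (Finset.mem_inter.2 ⟨h, hy⟩), hxy⟩
    · obtain ⟨x, hx⟩ := hne
      have hSD : ∀ y ∈ D, y ∉ S := fun y hy hyS => h1 ⟨y, Finset.mem_inter.2 ⟨hyS, hy⟩⟩
      have hxE : x ∈ E := (Finset.mem_union.1 (hS hx)).resolve_left fun h => hSD x h hx
      obtain ⟨y, hy, hxy⟩ := exists_near_of_mem_badPoints h.subset ((hE x).1 hxE)
      exact ⟨x, hx, y, Finset.mem_union_left _ hy, hSD y hy, by omega⟩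
  obtain ⟨w, hw, hDw⟩ := exists_walk_visiting (s := 6) hvis (Finset.mem_union_left E hx₀) hconn
  refine ⟨w, U, D, E, ?_, h, hE, hDw⟩
  have h1 := h.card_le
  have h2 := card_le_of_subset_badPoints a (knownSet U D) F E fun x hx => (hE x).1 hx
  have h3 := two_mul_le_card_edgeBoundary ⟨r, hr⟩
  have h4 := Finset.card_union_le D E
  rw [List.length_append, hp] at hw
  -- With `b` boundary edges, the terms are at most `b` for the ray, `b` for the step to `D`, and
  -- `12 * (32 + 2) * b` for the detours: in all `410 * b`.
  calc d * w.length ≤ d * (w₀.length + 2 + 12 * (D.card + E.card)) := by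
        gcongr
        omega
    _ = d * w₀.length + 2 * d + 12 * (d * D.card + d * E.card) := by ring
    _ ≤ _ := by omega

/-- The number of contours of a given size through a given vertex. -/
lemma card_contours_le {d : ℕ} (hd : 2 ≤ d) (r : Fin d → ℤ) (b : ℕ)
    (𝒢 : Finset (Finset (Fin d → ℤ)))
    (h𝒢 : ∀ F ∈ 𝒢, IsContour F ∧ r ∈ F ∧ (edgeBoundary F).card = b) :
    𝒢.card ≤ (2 * d) ^ (410 * b / d) * 16 ^ (410 * b / d + 1) := by
  classical
  let a : Dir d := (⟨0, by omega⟩, true)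
  set L := 410 * b / d
  have hcode : ∀ F ∈ 𝒢, ∃ (w : List.Vector (Dir d) L) (U D E : Finset (Fin d → ℤ)),
      IsCore F U D ∧ (∀ x, x ∈ E ↔ x ∈ badPoints a (knownSet U D) F) ∧
      D ∪ E ⊆ visited r w.1 := by
    intro F hF
    obtain ⟨h1, h2, h3⟩ := h𝒢 F hF
    obtain ⟨w, U, D, E, hw, hc, hE, hsub⟩ := h1.exists_code hd h2
    have hwL : w.length ≤ L := by
      rw [Nat.le_div_iff_mul_le (by omega), mul_comm, ← h3]
      exact hw
    -- Padding to the exact length `L` only enlarges the visited set.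
    refine ⟨⟨w ++ List.replicate (L - w.length) a, by simp; omega⟩, U, D, E, hc, hE, ?_⟩
    rw [visited_append]
    exact hsub.trans Finset.subset_union_left
  have : Nonempty (List.Vector (Dir d) L) := ⟨List.Vector.replicate L a⟩
  choose! w U D E hc hE hsub using hcode
  -- The code is a walk with four subsets of its at most `L + 1` vertices: `U`, `D`, `E` and the
  -- trace of `F` on `D ∪ E`. This gives `16 = 2 ^ 4` per vertex.
  let T : Finset (Σ _ : List.Vector (Dir d) L, Finset (Fin d → ℤ) × Finset (Fin d → ℤ) ×
      Finset (Fin d → ℤ) × Finset (Fin d → ℤ)) :=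
    Finset.univ.sigma fun w => (visited r w.1).powerset ×ˢ (visited r w.1).powerset ×ˢ
      (visited r w.1).powerset ×ˢ (visited r w.1).powerset
  have hT : T.card ≤ (2 * d) ^ L * 16 ^ (L + 1) := by
    rw [Finset.card_sigma]
    have : ∀ w ∈ (Finset.univ : Finset (List.Vector (Dir d) L)),
        ((visited r w.1).powerset ×ˢ (visited r w.1).powerset ×ˢ
        (visited r w.1).powerset ×ˢ (visited r w.1).powerset).card ≤ 16 ^ (L + 1) := by
      intro w _
      simp only [Finset.card_product, Finset.card_powerset]
      rw [← pow_add, ← pow_add, ← pow_add, show (16 : ℕ) = 2 ^ 4 by norm_num, ← pow_mul]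
      refine Nat.pow_le_pow_right (by norm_num) ?_
      have := card_visited_le r w.1
      rw [w.2] at this
      omega
    refine (Finset.sum_le_card_nsmul _ _ _ this).trans ?_
    rw [Finset.card_univ, card_vector, card_dir, smul_eq_mul]
  refine le_trans ?_ hT
  refine Finset.card_le_card_of_injOn
    (fun F => ⟨w F, U F, D F, E F, F ∩ (D F ∪ E F)⟩) ?_ ?_
  · intro F hF
    have h1 := hsub F hF
    have h2 := Finset.union_subset_iff.1 h1
    simp only [T, Finset.mem_coe, Finset.mem_sigma, Finset.mem_univ, Finset.mem_product,
      Finset.mem_powerset, true_and]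
    exact ⟨(hc F hF).subset.trans h2.1, h2.1, h2.2, Finset.inter_subset_right.trans h1⟩
  · intro F hF F' hF' heq
    simp only [Sigma.mk.injEq, heq_eq_eq, Prod.mk.injEq] at heq
    obtain ⟨-, hU, hD, hEE, hI⟩ := heq
    have hc' := hc F' hF'
    have hE' := hE F' hF'
    rw [← hU, ← hD] at hc' hE'
    rw [← hEE] at hE'
    have hmem : ∀ v ∈ D F ∪ E F, (v ∈ F ↔ v ∈ F') := by
      intro v hv
      have h1 : v ∈ F ∩ (D F ∪ E F) ↔ v ∈ F' ∩ (D F' ∪ E F') := by rw [hI]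
      rw [← hD, ← hEE, Finset.mem_inter, Finset.mem_inter] at h1
      tauto
    refine (hc F hF).eq_of_badPoints a hc' ?_ (fun v hv => hmem v (Finset.mem_union_left _ hv))
      fun v hv => hmem v (Finset.mem_union_right _ ((hE F hF v).2 hv))
    ext x
    rw [← hE F hF, ← hE']

/-! ### Level components and their hulls -/

/-- The level component of `τ` at the vertex `x`. -/
def levelComp {d : ℕ} (τ : Shift d) (x : Fin d → ℤ) : Set (Fin d → ℤ) :=
  {y | (levelGraph τ).Reachable x y}

lemma mem_levelComp {d : ℕ} {τ : Shift d} {x y : Fin d → ℤ} :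
    y ∈ levelComp τ x ↔ (levelGraph τ).Reachable x y := Iff.rfl

lemma self_mem_levelComp {d : ℕ} (τ : Shift d) (x : Fin d → ℤ) : x ∈ levelComp τ x :=
  SimpleGraph.Reachable.refl _

lemma levelComp_eq_of_mem {d : ℕ} {τ : Shift d} {x y : Fin d → ℤ} (h : y ∈ levelComp τ x) :
    levelComp τ y = levelComp τ x := by
  rw [mem_levelComp] at h
  ext z
  exact ⟨fun hz => h.trans hz, fun hz => h.symm.trans hz⟩

lemma apply_eq_of_mem_levelComp {d : ℕ} {τ : Shift d} {x y : Fin d → ℤ} (h : y ∈ levelComp τ x) :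
    τ y = τ x := (eq_of_reachable h).symm

lemma levelComp_mem_levelComponents {d : ℕ} (τ : Shift d) (x : Fin d → ℤ) :
    levelComp τ x ∈ levelComponents τ := by
  refine ⟨⟨?_, τ x, fun v hv => apply_eq_of_mem_levelComp hv⟩, ?_⟩
  · have key : ∀ y (h : (levelGraph τ).Reachable x y), ((lattice d).induce (levelComp τ x)).Reachable
        ⟨x, self_mem_levelComp τ x⟩ ⟨y, h⟩ := by
      intro y h
      have h' := (SimpleGraph.reachable_iff_reflTransGen x y).1 h
      induction h' with
      | refl => exact .refl _
      | @tail u v hu huv ih =>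
        have hxu := (SimpleGraph.reachable_iff_reflTransGen x u).2 hu
        refine (ih hxu).trans (SimpleGraph.Adj.reachable ?_)
        exact huv.1
    have : Nonempty (levelComp τ x) := ⟨⟨x, self_mem_levelComp τ x⟩⟩
    exact ⟨fun u v => (key u u.2).symm.trans (key v v.2)⟩
  · rintro B ⟨hB, k, hk⟩ hsub y hy
    let f : (lattice d).induce B →g levelGraph τ :=
      ⟨Subtype.val, fun {u v} h => ⟨h, (hk u u.2).trans (hk v v.2).symm⟩⟩
    exact (hB.preconnected ⟨x, hsub (self_mem_levelComp τ x)⟩ ⟨y, hy⟩).map f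

lemma finite_levelComp_of_ne_zero {d : ℕ} {τ : Shift d} {x : Fin d → ℤ} (h : τ x ≠ 0) :
    (levelComp τ x).Finite := by
  refine τ.support.finite_toSet.subset fun y hy => ?_
  rw [Finset.mem_coe, Finsupp.mem_support_iff, apply_eq_of_mem_levelComp hy]
  exact h

/-- The set `A` together with the finite components of its complement (for finite `A`). -/
def fill {d : ℕ} (A : Set (Fin d → ℤ)) : Set (Fin d → ℤ) :=
  {x | {y | (levelGraph (· ∈ A)).Reachable x y}.Finite}

lemma mem_fill_iff_of_reachable {d : ℕ} {A : Set (Fin d → ℤ)} {x y : Fin d → ℤ}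
    (h : (levelGraph (· ∈ A)).Reachable x y) : x ∈ fill A ↔ y ∈ fill A := by
  have : {z | (levelGraph (· ∈ A)).Reachable x z} = {z | (levelGraph (· ∈ A)).Reachable y z} := by
    ext z
    exact ⟨fun hz => h.symm.trans hz, fun hz => h.trans hz⟩
  unfold fill
  rw [Set.mem_ofPred_eq, Set.mem_ofPred_eq, this]

lemma subset_fill {d : ℕ} {A : Set (Fin d → ℤ)} (hA : A.Finite) : A ⊆ fill A := by
  intro x hx
  exact hA.subset fun y hy => (eq_of_reachable hy).mp hx

lemma reachable_fill_of_reachable {d : ℕ} {A : Set (Fin d → ℤ)} {x y : Fin d → ℤ}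
    (h : (levelGraph (· ∈ A)).Reachable x y) : (levelGraph (· ∈ fill A)).Reachable x y :=
  reachable_of_reachable h fun _ _ _ huv =>
    eq_iff_iff.2 (mem_fill_iff_of_reachable huv.reachable)

lemma mem_of_exit_fill {d : ℕ} {A : Set (Fin d → ℤ)} (hA : A.Finite) {x : Fin d → ℤ} {a : Dir d}
    (hx : x ∈ fill A) (hxa : x + stepVec a ∉ fill A) : x ∈ A ∧ x + stepVec a ∉ A := by
  have hxa' : x + stepVec a ∉ A := fun h => hxa (subset_fill hA h)
  refine ⟨?_, hxa'⟩
  by_contra hxA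
  have hadj : (levelGraph (· ∈ A)).Adj x (x + stepVec a) := levelGraph_adj_add (by simp [hxA, hxa'])
  exact hxa ((mem_fill_iff_of_reachable hadj.reachable).1 hx)

lemma finite_box {d : ℕ} (n : ℤ) : {x : Fin d → ℤ | ¬∃ i, n < |x i|}.Finite := by
  refine (Set.finite_Icc (fun _ => -n) (fun _ => n)).subset fun x hx => ?_
  simp only [Set.mem_ofPred_eq, not_exists, not_lt] at hx
  exact ⟨fun i => (abs_le.1 (hx i)).1, fun i => (abs_le.1 (hx i)).2⟩

lemma infinite_lattice {d : ℕ} (hd : 0 < d) : (Set.univ : Set (Fin d → ℤ)).Infinite := by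
  have : Nonempty (Fin d) := ⟨⟨0, hd⟩⟩
  exact Set.infinite_univ

lemma finite_fill {d : ℕ} (hd : 2 ≤ d) {A : Set (Fin d → ℤ)} (hA : A.Finite) : (fill A).Finite := by
  obtain ⟨n, hn⟩ := exists_far_reachable hd hA
  refine (finite_box n).subset fun x hx hfar => ?_
  refine infinite_lattice (d := d) (by omega) (((finite_box n).union hx).subset fun y _ => ?_)
  by_cases hy : ∃ i, n < |y i|
  · exact .inr (hn x y hfar hy)
  · exact .inl hy

lemma exists_far_of_notMem_fill {d : ℕ} {A : Set (Fin d → ℤ)} {x : Fin d → ℤ} (hx : x ∉ fill A)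
    (n : ℤ) : ∃ y, (levelGraph (· ∈ A)).Reachable x y ∧ ∃ i, n < |y i| := by
  by_contra! hcon
  refine hx ((finite_box n).subset fun y hy => ?_)
  simpa using hcon y hy

/-- An infinite component leaves every box, and all points outside a large box are connected off
`A`; so only one component is not filled. -/
lemma reachable_of_notMem_fill {d : ℕ} (hd : 2 ≤ d) {A : Set (Fin d → ℤ)} (hA : A.Finite)
    {x y : Fin d → ℤ} (hx : x ∉ fill A) (hy : y ∉ fill A) :
    (levelGraph (· ∈ A)).Reachable x y := by
  obtain ⟨n, hn⟩ := exists_far_reachable hd hA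
  obtain ⟨x', hx', hfx⟩ := exists_far_of_notMem_fill hx n
  obtain ⟨y', hy', hfy⟩ := exists_far_of_notMem_fill hy n
  exact hx'.trans ((hn x' y' hfx hfy).trans hy'.symm)

lemma exists_reachable_mem {d : ℕ} (hd : 2 ≤ d) {A : Set (Fin d → ℤ)} (hA : A.Finite)
    {x : Fin d → ℤ} (hx : x ∈ fill A) : ∃ y ∈ A, (levelGraph (· ∈ fill A)).Reachable x y := by
  by_cases hxA : x ∈ A
  · exact ⟨x, hxA, .refl _⟩
  let a : Dir d := (⟨0, by omega⟩, true)
  obtain ⟨z, hz, hza, -⟩ := exists_exit hx ⟨x, .refl _⟩ a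
  have hzA : z ∉ A := fun h => hxA ((eq_of_reachable hz).mpr h)
  have hzaA : z + stepVec a ∈ A := by
    by_contra h
    exact hza (SimpleGraph.Reachable.trans hz (levelGraph_adj_add (by simp [hzA, h])).reachable)
  have hzf : z ∈ fill A := (mem_fill_iff_of_reachable hz).1 hx
  exact ⟨_, hzaA, (reachable_fill_of_reachable hz).trans
    (levelGraph_adj_add (by simp [hzf, subset_fill hA hzaA])).reachable⟩

open Classical in
/-- The filled level component of `τ` at `x` (for finite components). -/
noncomputable def hull {d : ℕ} (τ : Shift d) (x : Fin d → ℤ) : Finset (Fin d → ℤ) :=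
  if h : (fill (levelComp τ x)).Finite then h.toFinset else ∅

lemma mem_hull {d : ℕ} (hd : 2 ≤ d) {τ : Shift d} {x y : Fin d → ℤ}
    (hx : (levelComp τ x).Finite) : y ∈ hull τ x ↔ y ∈ fill (levelComp τ x) := by
  simp [hull, finite_fill hd hx]

lemma self_mem_hull {d : ℕ} (hd : 2 ≤ d) {τ : Shift d} {x : Fin d → ℤ}
    (hx : (levelComp τ x).Finite) : x ∈ hull τ x :=
  (mem_hull hd hx).2 (subset_fill hx (self_mem_levelComp τ x))

lemma isContour_hull {d : ℕ} (hd : 2 ≤ d) {τ : Shift d} {x : Fin d → ℤ}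
    (hx : (levelComp τ x).Finite) : IsContour (hull τ x) := by
  intro u v huv
  have he : (· ∈ hull τ x) = (· ∈ fill (levelComp τ x)) := by
    funext z; exact propext (mem_hull hd hx)
  rw [he]
  rw [mem_hull hd hx, mem_hull hd hx] at huv
  by_cases hu : u ∈ fill (levelComp τ x)
  · obtain ⟨u', hu', huu'⟩ := exists_reachable_mem hd hx hu
    obtain ⟨v', hv', hvv'⟩ := exists_reachable_mem hd hx (huv.1 hu)
    refine huu'.trans (SimpleGraph.Reachable.trans ?_ hvv'.symm)
    have h : (levelGraph τ).Reachable u' v' :=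
      SimpleGraph.Reachable.trans (SimpleGraph.Reachable.symm hu') hv'
    refine reachable_of_reachable h fun p q hp hpq => ?_
    have hpA : p ∈ levelComp τ x := SimpleGraph.Reachable.trans hu' hp
    have hqA : q ∈ levelComp τ x := SimpleGraph.Reachable.trans hpA hpq.reachable
    simp [subset_fill hx hpA, subset_fill hx hqA]
  · exact reachable_fill_of_reachable
      (reachable_of_notMem_fill hd hx hu (fun h => hu (huv.2 h)))

lemma mem_levelComp_of_exit_hull {d : ℕ} (hd : 2 ≤ d) {τ : Shift d} {x y : Fin d → ℤ}
    (hx : (levelComp τ x).Finite) {a : Dir d} (h : y ∈ hull τ x) (h' : y + stepVec a ∉ hull τ x) :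
    y ∈ levelComp τ x ∧ τ y ≠ τ (y + stepVec a) := by
  rw [mem_hull hd hx] at h h'
  obtain ⟨h1, h2⟩ := mem_of_exit_fill hx h h'
  refine ⟨h1, fun he => h2 ?_⟩
  exact SimpleGraph.Reachable.trans h1 (levelGraph_adj_add he).reachable

lemma levelComp_subset_hull {d : ℕ} (hd : 2 ≤ d) {τ : Shift d} {x y : Fin d → ℤ}
    (hx : (levelComp τ x).Finite) (hy : y ∈ hull τ x) : ∀ z ∈ levelComp τ y, z ∈ hull τ x := by
  intro z hz
  by_cases hyx : y ∈ levelComp τ x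
  · rw [levelComp_eq_of_mem hyx] at hz
    exact (mem_hull hd hx).2 (subset_fill hx hz)
  · rw [mem_hull hd hx] at hy ⊢
    refine (mem_fill_iff_of_reachable (reachable_of_reachable hz fun u v hu huv => ?_)).1 hy
    have h1 : u ∉ levelComp τ x := fun h => hyx
      (SimpleGraph.Reachable.trans h (SimpleGraph.Reachable.symm hu))
    have h2 : v ∉ levelComp τ x := fun h => h1
      (SimpleGraph.Reachable.trans h huv.symm.reachable)
    simp [h1, h2]

lemma finite_levelComp_of_mem_hull {d : ℕ} (hd : 2 ≤ d) {τ : Shift d} {x y : Fin d → ℤ}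
    (hx : (levelComp τ x).Finite) (hy : y ∈ hull τ x) : (levelComp τ y).Finite :=
  (hull τ x).finite_toSet.subset fun z hz => levelComp_subset_hull hd hx hy z hz

/-- The complement of the outer hull is connected, infinite and disjoint from the component of `y`.
A point of it therefore lies in an infinite component off `levelComp τ y` and cannot be filled. -/
lemma hull_subset_hull {d : ℕ} (hd : 2 ≤ d) {τ : Shift d} {x y : Fin d → ℤ}
    (hx : (levelComp τ x).Finite) (hy : y ∈ hull τ x) : hull τ y ⊆ hull τ x := by
  intro z hz
  by_contra hzx
  have hyf := finite_levelComp_of_mem_hull hd hx hy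
  rw [mem_hull hd hyf] at hz
  refine infinite_lattice (d := d) (by omega)
    (((hull τ x).finite_toSet.union hz).subset fun w _ => ?_)
  by_cases hw : w ∈ hull τ x
  · exact .inl hw
  right
  refine reachable_of_reachable (isContour_hull hd hx z w (by simp [hzx, hw])) ?_
  intro u v hu huv
  have h1 : u ∉ hull τ x := fun h => hzx ((eq_of_reachable hu).mpr h)
  have h2 : v ∉ hull τ x := fun h => h1 (huv.2.mpr h)
  have h3 : u ∉ levelComp τ y := fun h => h1 (levelComp_subset_hull hd hx hy u h)
  have h4 : v ∉ levelComp τ y := fun h => h2 (levelComp_subset_hull hd hx hy v h)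
  simp [h3, h4]

lemma hull_eq_of_mem_levelComp {d : ℕ} {τ : Shift d} {x y : Fin d → ℤ}
    (hy : y ∈ levelComp τ x) : hull τ y = hull τ x := by
  unfold hull
  rw [levelComp_eq_of_mem hy]

lemma exitPoint_hull_mem {d : ℕ} (hd : 2 ≤ d) {τ : Shift d} {x : Fin d → ℤ}
    (hx : (levelComp τ x).Finite) (a : Dir d) : exitPoint a (hull τ x) ∈ levelComp τ x := by
  obtain ⟨h1, h2, -⟩ := exitPoint_spec a ⟨x, self_mem_hull hd hx⟩
  exact (mem_levelComp_of_exit_hull hd hx h1 h2).1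

/-- A level component is recovered from the family of all filled level components. -/
lemma mem_levelComp_iff_hull {d : ℕ} (hd : 2 ≤ d) {τ : Shift d} {x y : Fin d → ℤ}
    (hx : (levelComp τ x).Finite) : y ∈ levelComp τ x ↔
    y ∈ hull τ x ∧ ∀ z, (levelComp τ z).Finite → y ∈ hull τ z → hull τ x ⊆ hull τ z := by
  constructor
  · intro h
    refine ⟨(mem_hull hd hx).2 (subset_fill hx h), fun z hz hyz => ?_⟩
    rw [← hull_eq_of_mem_levelComp h]
    exact hull_subset_hull hd hz hyz
  · rintro ⟨h1, h2⟩
    have hyf := finite_levelComp_of_mem_hull hd hx h1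
    -- Components with equal hulls coincide, because the extremal point of the hull belongs to both.
    have he : hull τ x = hull τ y :=
      (h2 y hyf (self_mem_hull hd hyf)).antisymm (hull_subset_hull hd hx h1)
    let a : Dir d := (⟨0, by omega⟩, true)
    have h3 := exitPoint_hull_mem hd hx a
    have h4 := exitPoint_hull_mem hd hyf a
    rw [← he] at h4
    rw [← levelComp_eq_of_mem h3, levelComp_eq_of_mem h4]
    exact self_mem_levelComp τ y

/-! ### Recovering a shift from its hulls -/

/-- The points `w i` represent the finite level components of `τ`, without repetition. -/
structure IsTransversal {d N : ℕ} (τ : Shift d) (w : Fin N → Fin d → ℤ) : Prop where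
  finite : ∀ i, (levelComp τ (w i)).Finite
  injective : ∀ i j, w j ∈ levelComp τ (w i) → i = j
  exists_mem : ∀ x, (levelComp τ x).Finite → ∃ i, x ∈ levelComp τ (w i)

lemma IsTransversal.mem_levelComp_iff {d N : ℕ} (hd : 2 ≤ d) {τ : Shift d} {w : Fin N → Fin d → ℤ}
    (h : IsTransversal τ w) {i : Fin N} {y : Fin d → ℤ} : y ∈ levelComp τ (w i) ↔
    y ∈ hull τ (w i) ∧ ∀ j, y ∈ hull τ (w j) → hull τ (w i) ⊆ hull τ (w j) := by
  rw [mem_levelComp_iff_hull hd (h.finite i)]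
  refine and_congr_right fun _ => ⟨fun H j => H (w j) (h.finite j), fun H z hz hyz => ?_⟩
  obtain ⟨j, hj⟩ := h.exists_mem z hz
  rw [hull_eq_of_mem_levelComp hj] at hyz ⊢
  exact H j hyz

lemma IsTransversal.apply_eq_zero {d N : ℕ} {τ : Shift d} {w : Fin N → Fin d → ℤ}
    (h : IsTransversal τ w) {y : Fin d → ℤ} (hy : ∀ i, y ∉ levelComp τ (w i)) : τ y = 0 := by
  by_contra h0
  obtain ⟨i, hi⟩ := h.exists_mem y (finite_levelComp_of_ne_zero h0)
  exact hy i hi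

/-- A shift is determined by its filled level components and the jumps at extremal points. -/
lemma IsTransversal.eq_of_hull {d N : ℕ} (hd : 2 ≤ d) {τ τ' : Shift d} {w w' : Fin N → Fin d → ℤ}
    (h : IsTransversal τ w) (h' : IsTransversal τ' w') (a : Dir d)
    (hF : ∀ i, hull τ (w i) = hull τ' (w' i))
    (hΔ : ∀ i, τ (exitPoint a (hull τ (w i))) - τ (exitPoint a (hull τ (w i)) + stepVec a) =
      τ' (exitPoint a (hull τ' (w' i))) - τ' (exitPoint a (hull τ' (w' i)) + stepVec a)) :
    τ = τ' := by
  have hcomp : ∀ i y, y ∈ levelComp τ (w i) ↔ y ∈ levelComp τ' (w' i) := by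
    intro i y
    rw [h.mem_levelComp_iff hd, h'.mem_levelComp_iff hd]
    simp only [hF]
  let u : Fin N → Fin d → ℤ := fun i => exitPoint a (hull τ (w i))
  have hu : ∀ i, u i ∈ levelComp τ (w i) := fun i => exitPoint_hull_mem hd (h.finite i) a
  have hval : ∀ i y, y ∈ levelComp τ (w i) → τ (u i) = τ' (u i) → τ y = τ' y := by
    intro i y hy he
    rw [apply_eq_of_mem_levelComp hy, ← apply_eq_of_mem_levelComp (hu i), he,
      apply_eq_of_mem_levelComp ((hcomp i _).1 (hu i)),
      ← apply_eq_of_mem_levelComp ((hcomp i _).1 hy)]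
  have hout : ∀ y, (∀ i, y ∉ levelComp τ (w i)) → τ y = τ' y := by
    intro y hy
    rw [h.apply_eq_zero hy, h'.apply_eq_zero fun i hi => hy i ((hcomp i y).2 hi)]
  -- Among the disagreeing indices, take one whose extremal point is highest in direction `a`. One
  -- step further lies either outside all finite components, where both shifts vanish, or in a
  -- component with a strictly higher extremal point, where they agree. Equality of the jumps
  -- carries the agreement back.
  have hmain : ∀ i, τ (u i) = τ' (u i) := by
    by_contra! hcon
    let height : (Fin d → ℤ) → ℤ := fun y => if a.2 then y a.1 else -y a.1
    let s := Finset.univ.filter fun i => τ (u i) ≠ τ' (u i)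
    obtain ⟨i, hi, hmax⟩ := s.exists_max_image (fun i => height (u i))
      ⟨hcon.choose, by simpa [s] using hcon.choose_spec⟩
    refine (Finset.mem_filter.1 hi).2 ?_
    have h1 : τ (u i + stepVec a) = τ' (u i + stepVec a) := by
      by_cases hex : ∃ j, u i + stepVec a ∈ levelComp τ (w j)
      · obtain ⟨j, hj⟩ := hex
        refine hval j _ hj ?_
        by_contra hne
        have h2 := hmax j (by simpa [s] using hne)
        have h3 : height (u i + stepVec a) ≤ height (u j) :=
          (exitPoint_spec a ⟨w j, self_mem_hull hd (h.finite j)⟩).2.2 _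
            ((h.mem_levelComp_iff hd).1 hj).1
        have h4 : height (u i + stepVec a) = height (u i) + 1 := by
          rcases a with ⟨k, _ | _⟩ <;> simp [height, stepVec]; ring
        omega
      · exact hout _ (by simpa using hex)
    have h2 := hΔ i
    rw [← hF i] at h2
    change τ (u i) - τ (u i + stepVec a) = τ' (u i) - τ' (u i + stepVec a) at h2
    omega
  ext y
  by_cases hex : ∃ j, y ∈ levelComp τ (w j)
  · obtain ⟨j, hj⟩ := hex
    exact hval j y hj (hmain j)
  · exact hout y (by simpa using hex)

lemma sum_natAbs_le {d : ℕ} (τ : Shift d) (S : Finset ((Fin d → ℤ) × Dir d)) :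
    ∑ p ∈ S, (τ p.1 - τ (p.1 + stepVec p.2)).natAbs ≤ 2 * totalVariation τ := by
  classical
  let π : (Fin d → ℤ) × Dir d → Sym2 (Fin d → ℤ) := fun p => s(p.1, p.1 + stepVec p.2)
  have hfib : ∀ e ∈ S.image π, (S.filter fun p => π p = e).card ≤ 2 := by
    intro e he
    obtain ⟨⟨v, a⟩, -, rfl⟩ := Finset.mem_image.1 he
    refine (Finset.card_le_card (t := {(v, a), (v + stepVec a, a.opp)}) ?_).trans Finset.card_le_two
    rintro ⟨v', a'⟩ hp
    have := (Finset.mem_filter.1 hp).2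
    simp only [π, Sym2.eq_iff] at this
    simp only [Finset.mem_insert, Finset.mem_singleton, Prod.mk.injEq]
    rcases this with ⟨rfl, h⟩ | ⟨rfl, h⟩
    · exact .inl ⟨rfl, stepVec_injective (add_left_cancel h)⟩
    · refine .inr ⟨rfl, stepVec_injective ?_⟩
      rw [stepVec_opp]
      rw [add_assoc] at h
      exact eq_neg_of_add_eq_zero_right (by simpa using h)
  have h1 : ∑ p ∈ S, (τ p.1 - τ (p.1 + stepVec p.2)).natAbs = ∑ p ∈ S, edgeDiff τ (π p) := rfl
  rw [h1, Finset.sum_comp (edgeDiff τ) π]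
  calc ∑ e ∈ S.image π, (S.filter fun p => π p = e).card • edgeDiff τ e
      ≤ ∑ e ∈ S.image π, 2 * edgeDiff τ e :=
        Finset.sum_le_sum fun e he => Nat.mul_le_mul_right _ (hfib e he)
    _ = 2 * ∑ e ∈ S.image π, edgeDiff τ e := (Finset.mul_sum _ _ _).symm
    _ ≤ _ := by
      refine Nat.mul_le_mul_left _ ?_
      unfold totalVariation
      rw [finsum_mem_eq_sum_of_inter_support_eq (edgeDiff τ)
        (t := (finite_support_edgeDiff τ).toFinset) (by simp [Set.inter_assoc])]
      rw [← Finset.sum_filter_ne_zero]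
      refine Finset.sum_le_sum_of_subset fun e he => ?_
      obtain ⟨he1, he2⟩ := Finset.mem_filter.1 he
      obtain ⟨⟨v, a⟩, -, rfl⟩ := Finset.mem_image.1 he1
      rw [Set.Finite.mem_toFinset]
      exact ⟨adj_add_stepVec v a, he2⟩

lemma IsTransversal.eq_of_mem {d N : ℕ} {τ : Shift d} {w : Fin N → Fin d → ℤ}
    (h : IsTransversal τ w) {i j : Fin N} {y : Fin d → ℤ} (hi : y ∈ levelComp τ (w i))
    (hj : y ∈ levelComp τ (w j)) : i = j := by
  refine h.injective i j ?_
  rw [← levelComp_eq_of_mem hi, levelComp_eq_of_mem hj]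
  exact self_mem_levelComp τ _

/-- An exit dart of a hull starts in the level component itself. So darts of different hulls are
distinct, even for nested hulls, and each carries a jump of at least `1`; the factor `2` allows for
both orientations of an edge. -/
lemma IsTransversal.sum_card_edgeBoundary_le {d N : ℕ} (hd : 2 ≤ d) {τ : Shift d}
    {w : Fin N → Fin d → ℤ}
    (h : IsTransversal τ w) :
    ∑ i, (edgeBoundary (hull τ (w i))).card ≤ 2 * totalVariation τ := by
  classical
  have hmem : ∀ i, ∀ p ∈ edgeBoundary (hull τ (w i)),
      p.1 ∈ levelComp τ (w i) ∧ τ p.1 ≠ τ (p.1 + stepVec p.2) := fun i p hp =>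
    mem_levelComp_of_exit_hull hd (h.finite i) (mem_edgeBoundary.1 hp).1 (mem_edgeBoundary.1 hp).2
  rw [← Finset.card_biUnion]
  · refine le_trans ?_ (sum_natAbs_le τ (Finset.univ.biUnion fun i => edgeBoundary (hull τ (w i))))
    rw [Finset.card_eq_sum_ones]
    refine Finset.sum_le_sum fun p hp => ?_
    obtain ⟨i, -, hp⟩ := Finset.mem_biUnion.1 hp
    have := (hmem i p hp).2
    omega
  · intro i _ j _ hij
    rw [Function.onFun, Finset.disjoint_left]
    exact fun p hp hp' => hij (h.eq_of_mem (hmem i p hp).1 (hmem j p hp').1)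

lemma IsTransversal.sum_jump_le {d N : ℕ} (hd : 2 ≤ d) {τ : Shift d} {w : Fin N → Fin d → ℤ}
    (h : IsTransversal τ w) (a : Dir d) :
    ∑ i, (τ (exitPoint a (hull τ (w i))) -
      τ (exitPoint a (hull τ (w i)) + stepVec a)).natAbs ≤ 2 * totalVariation τ := by
  classical
  refine le_trans (le_of_eq ?_)
    (sum_natAbs_le τ (Finset.univ.image fun i => (exitPoint a (hull τ (w i)), a)))
  rw [Finset.sum_image]
  intro i _ j _ hij
  have hij := (Prod.mk.inj hij).1
  have h1 := exitPoint_hull_mem hd (h.finite i) a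
  rw [hij] at h1
  exact h.eq_of_mem h1 (exitPoint_hull_mem hd (h.finite j) a)

/-! ### Representatives along an optimal trip -/

/-- The length of the trip from `x` through the points of a list. -/
def pathLen {d : ℕ} : (Fin d → ℤ) → List (Fin d → ℤ) → ℕ
  | _, [] => 0
  | x, y :: l => l1Dist x y + pathLen y l

lemma pathLen_le_add {d : ℕ} (x y : Fin d → ℤ) (l : List (Fin d → ℤ)) :
    pathLen x l ≤ l1Dist x y + pathLen y l := by
  cases l with
  | nil => simp [pathLen]
  | cons z l =>
    have := l1Dist_triangle x y z
    simp only [pathLen]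
    omega

lemma pathLen_le_of_sublist {d : ℕ} {l l' : List (Fin d → ℤ)} (h : l'.Sublist l)
    (x : Fin d → ℤ) : pathLen x l' ≤ pathLen x l := by
  induction h generalizing x with
  | slnil => rfl
  | cons y _ ih => exact (pathLen_le_add x y _).trans (Nat.add_le_add_left (ih y) _)
  | cons_cons y _ ih => exact Nat.add_le_add_left (ih y) _

lemma pathLen_ofFn_succ {d n : ℕ} (v : Fin (n + 1) → Fin d → ℤ) :
    pathLen (v 0) (List.ofFn fun i : Fin n => v i.succ) = tripLength v := by
  induction n with
  | zero => simp [pathLen, tripLength]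
  | succ n ih =>
    rw [List.ofFn_succ, pathLen, tripLength, Fin.sum_univ_succ, l1Dist_comm]
    congr 1
    exact ih fun i => v i.succ

lemma exists_sublist_nodup {α β : Type*} (f : α → β) (p : α → Prop) (l : List α) :
    ∃ l' : List α, l'.Sublist l ∧ (l'.map f).Nodup ∧ (∀ x ∈ l', p x) ∧
      ∀ x ∈ l, p x → ∃ y ∈ l', f y = f x := by
  classical
  induction l with
  | nil => exact ⟨[], .slnil, by simp, by simp, by simp⟩
  | cons x l ih =>
    obtain ⟨l', h1, h2, h3, h4⟩ := ih
    by_cases hx : p x ∧ f x ∉ l'.map f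
    · refine ⟨x :: l', h1.cons_cons x, by simpa using ⟨by simpa using hx.2, h2⟩, ?_, ?_⟩
      · intro y hy
        rcases List.mem_cons.1 hy with rfl | hy
        · exact hx.1
        · exact h3 y hy
      · intro y hy hpy
        rcases List.mem_cons.1 hy with rfl | hy
        · exact ⟨y, by simp, rfl⟩
        · obtain ⟨z, hz, he⟩ := h4 y hy hpy
          exact ⟨z, List.mem_cons_of_mem _ hz, he⟩
    · refine ⟨l', h1.cons x, h2, h3, fun y hy hpy => ?_⟩
      rcases List.mem_cons.1 hy with rfl | hy
      · have : f y ∈ l'.map f := by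
          by_contra hcon
          exact hx ⟨hpy, hcon⟩
        simpa using this
      · exact h4 y hy hpy

/-- An optimal root sequence is thinned to one point per finite level component. By the triangle
inequality, skipping points does not lengthen the trip. -/
lemma exists_isTransversal {d : ℕ} (τ : Shift d) :
    ∃ (N : ℕ) (w : Fin N → Fin d → ℤ), IsTransversal τ w ∧
      pathLen 0 (List.ofFn w) ≤ tripEntropy τ := by
  obtain ⟨n, v, ⟨hv0, hv⟩, hlen⟩ := exists_tripLength_eq_tripEntropy τ
  obtain ⟨l, hsub, hnd, hfin, hex⟩ := exists_sublist_nodup (levelComp τ)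
    (fun x => (levelComp τ x).Finite) (List.ofFn v)
  refine ⟨l.length, l.get, ⟨fun i => hfin _ (l.get_mem i), fun i j hij => ?_, fun x hx => ?_⟩, ?_⟩
  · have he := levelComp_eq_of_mem hij
    have hi : (l.map (levelComp τ))[i.1]'(by simp) = (l.map (levelComp τ))[j.1]'(by simp) := by
      simpa using he.symm
    exact Fin.ext ((hnd.getElem_inj_iff).1 hi)
  · obtain ⟨i, hi⟩ := hv _ (levelComp_mem_levelComponents τ x)
    have he := levelComp_eq_of_mem hi
    obtain ⟨y, hy, hyx⟩ := hex (v i) (by rw [List.mem_ofFn]; exact ⟨i, rfl⟩) (he ▸ hx)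
    obtain ⟨j, rfl⟩ := List.mem_iff_get.1 hy
    exact ⟨j, by rw [hyx, he]; exact self_mem_levelComp τ x⟩
  · rw [List.ofFn_get, ← hlen, ← pathLen_ofFn_succ, ← hv0]
    refine (pathLen_le_of_sublist hsub _).trans ?_
    rw [List.ofFn_succ, pathLen, l1Dist_self, zero_add]

/-! ### Generating functions for trips and integer sequences -/

section
open Finset

lemma sum_pow_natAbs_le {q : ℝ} (h0 : 0 < q) (h1 : q < 1) (S : Finset ℤ) (c : ℤ) :
    ∑ k ∈ S, q ^ (c - k).natAbs ≤ (1 + q) / (1 - q) := by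
  have hs : HasSum (fun k : ℤ => q ^ k.natAbs) ((1 + q) / (1 - q)) := by
    have hg := hasSum_geometric_of_lt_one h0.le h1
    have := HasSum.of_nat_of_neg_add_one (f := fun k : ℤ => q ^ k.natAbs)
      (m := (1 - q)⁻¹) (m' := q * (1 - q)⁻¹) (by simpa using hg) (by
        have e : (fun n : ℕ => q ^ (-((n : ℤ) + 1)).natAbs) = fun n => q * q ^ n := by
          funext n
          rw [← pow_succ']
          congr 1
        rw [e]
        exact hg.mul_left q)
    convert this using 1
    rw [div_eq_mul_inv]
    ring
  have h2 : ∑ k ∈ S, q ^ (c - k).natAbs = ∑ m ∈ S.image (fun k => c - k), q ^ m.natAbs := by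
    rw [Finset.sum_image fun a _ b _ h => by simpa using h]
  rw [h2]
  exact sum_le_hasSum _ (fun _ _ => by positivity) hs

lemma sum_pow_dist_le {ι : Type*} [Fintype ι] [DecidableEq ι] {q : ℝ} (h0 : 0 < q) (h1 : q < 1)
    (S : Finset (ι → ℤ)) (c : ι → ℤ) :
    ∑ y ∈ S, q ^ (∑ i, (c i - y i).natAbs) ≤ ((1 + q) / (1 - q)) ^ Fintype.card ι := by
  have hsub : S ⊆ Fintype.piFinset fun i => S.image fun y => y i := by
    intro y hy
    rw [Fintype.mem_piFinset]
    exact fun i => Finset.mem_image_of_mem _ hy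
  refine (Finset.sum_le_sum_of_subset_of_nonneg hsub fun _ _ _ => by positivity).trans ?_
  simp_rw [← Finset.prod_pow_eq_pow_sum]
  rw [← Finset.prod_univ_sum (fun i => S.image fun y => y i) fun i k => q ^ (c i - k).natAbs]
  refine (Finset.prod_le_prod (fun _ _ => Finset.sum_nonneg fun _ _ => by positivity)
    fun i _ => sum_pow_natAbs_le h0 h1 _ (c i)).trans ?_
  rw [Finset.prod_const, Finset.card_univ]

/-- Summing over the first point of the trip splits off a factor that is a product of `d` two-sided
geometric series, each at most `(1 + q) / (1 - q)`. -/
lemma sum_pow_pathLen_le {d : ℕ} {q : ℝ} (h0 : 0 < q) (h1 : q < 1) (N : ℕ) (x : Fin d → ℤ)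
    (S : Finset (List (Fin d → ℤ))) (hS : ∀ l ∈ S, l.length = N) :
    ∑ l ∈ S, q ^ pathLen x l ≤ (((1 + q) / (1 - q)) ^ d) ^ N := by
  have hZ : 0 ≤ ((1 + q) / (1 - q)) ^ d := pow_nonneg (div_nonneg (by linarith) (by linarith)) _
  induction N generalizing x S with
  | zero =>
    have : S ⊆ {[]} := fun l hl => by simpa using hS l hl
    refine (Finset.sum_le_sum_of_subset_of_nonneg this fun _ _ _ => by positivity).trans ?_
    simp [pathLen]
  | succ N ih =>
    let Y := S.image fun l => l.headD 0
    let T : (Fin d → ℤ) → Finset (List (Fin d → ℤ)) := fun y =>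
      (S.filter fun l => l.headD 0 = y).image List.tail
    have hT : ∀ y, ∑ l ∈ S with l.headD 0 = y, q ^ pathLen x l =
        q ^ l1Dist x y * ∑ t ∈ T y, q ^ pathLen y t := by
      intro y
      rw [Finset.sum_image, Finset.mul_sum]
      · refine Finset.sum_congr rfl fun l hl => ?_
        obtain ⟨hl, hy⟩ := Finset.mem_filter.1 hl
        cases l with
        | nil => simpa using hS _ hl
        | cons z l =>
          simp only [List.headD_cons] at hy
          subst hy
          rw [pathLen, pow_add, List.tail_cons]
      · intro l hl l' hl' he
        obtain ⟨hl, hy⟩ := Finset.mem_filter.1 hl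
        obtain ⟨hl', hy'⟩ := Finset.mem_filter.1 hl'
        cases l with
        | nil => simpa using hS _ hl
        | cons z l =>
          cases l' with
          | nil => simpa using hS _ hl'
          | cons z' l' =>
            simp only [List.headD_cons, List.tail_cons] at hy hy' he
            rw [hy, hy', he]
    rw [← Finset.sum_fiberwise_of_maps_to (g := fun l => l.headD 0) (t := Y)
      fun l hl => Finset.mem_image_of_mem _ hl]
    calc ∑ y ∈ Y, ∑ l ∈ S with l.headD 0 = y, q ^ pathLen x l
        ≤ ∑ y ∈ Y, q ^ l1Dist x y * (((1 + q) / (1 - q)) ^ d) ^ N := by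
          refine Finset.sum_le_sum fun y _ => ?_
          rw [hT]
          refine mul_le_mul_of_nonneg_left (ih y (T y) fun t ht => ?_) (by positivity)
          obtain ⟨l, hl, rfl⟩ := Finset.mem_image.1 ht
          rw [List.length_tail, hS l (Finset.mem_filter.1 hl).1, Nat.add_sub_cancel]
      _ = (∑ y ∈ Y, q ^ l1Dist x y) * (((1 + q) / (1 - q)) ^ d) ^ N :=
          (Finset.sum_mul _ _ _).symm
      _ ≤ ((1 + q) / (1 - q)) ^ d * (((1 + q) / (1 - q)) ^ d) ^ N := by
          refine mul_le_mul_of_nonneg_right ?_ (pow_nonneg hZ _)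
          have := sum_pow_dist_le h0 h1 Y x
          rwa [Fintype.card_fin] at this
      _ = _ := (pow_succ' _ _).symm

/-- Exponential Markov inequality for counting. -/
lemma card_le_of_sum_pow_le {α : Type*} {q Z m : ℝ} (h0 : 0 < q) (h1 : q < 1) {S : Finset α}
    {f : α → ℕ} (hf : ∀ x ∈ S, (f x : ℝ) ≤ m) (hZ : ∑ x ∈ S, q ^ f x ≤ Z) :
    (S.card : ℝ) ≤ Real.exp (m * -Real.log q) * Z := by
  have h2 : ∀ x ∈ S, Real.exp (m * Real.log q) ≤ q ^ f x := by
    intro x hx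
    rw [← Real.exp_log (pow_pos h0 _), Real.log_pow]
    exact Real.exp_le_exp.2 (mul_le_mul_of_nonpos_right (hf x hx) (Real.log_nonpos h0.le h1.le))
  have h3 := (Finset.card_nsmul_le_sum S _ _ h2).trans hZ
  rw [nsmul_eq_mul] at h3
  have h4 : Real.exp (m * -Real.log q) * Real.exp (m * Real.log q) = 1 := by
    rw [← Real.exp_add]; simp
  calc (S.card : ℝ) = Real.exp (m * -Real.log q) * (S.card * Real.exp (m * Real.log q)) := by
        rw [mul_left_comm, h4, mul_one]
    _ ≤ _ := mul_le_mul_of_nonneg_left h3 (Real.exp_pos _).le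

lemma card_trips_le {d N : ℕ} {q m : ℝ} (h0 : 0 < q) (h1 : q < 1)
    (S : Finset (Fin N → Fin d → ℤ)) (hS : ∀ w ∈ S, (pathLen 0 (List.ofFn w) : ℝ) ≤ m) :
    (S.card : ℝ) ≤ Real.exp (m * -Real.log q) * ((1 + q) / (1 - q)) ^ (d * N) := by
  classical
  refine card_le_of_sum_pow_le h0 h1 hS ?_
  rw [pow_mul]
  have := sum_pow_pathLen_le h0 h1 N (0 : Fin d → ℤ) (S.image List.ofFn) fun l hl => by
    obtain ⟨w, -, rfl⟩ := Finset.mem_image.1 hl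
    simp
  rwa [Finset.sum_image fun a _ b _ h => List.ofFn_injective h] at this

lemma card_sequences_le {N : ℕ} {q m : ℝ} (h0 : 0 < q) (h1 : q < 1)
    (S : Finset (Fin N → ℤ)) (hS : ∀ w ∈ S, ((∑ i, (w i).natAbs : ℕ) : ℝ) ≤ m) :
    (S.card : ℝ) ≤ Real.exp (m * -Real.log q) * ((1 + q) / (1 - q)) ^ N := by
  refine card_le_of_sum_pow_le h0 h1 hS ?_
  have := sum_pow_dist_le h0 h1 S 0
  simpa using this

end

/-! ### Assembling the exponential bounds -/

lemma one_le_two_mul_log {d : ℕ} (hd : 2 ≤ d) : 1 ≤ 2 * Real.log d := by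
  have h1 : Real.log 2 ≤ Real.log d := Real.log_le_log (by norm_num) (by exact_mod_cast hd)
  have h2 := Real.log_two_gt_d9
  linarith

/-- Since `b ≥ 2 * d`, the rounding term `+ 1` is absorbed into `411 * (b / d)`; with `32 * d ≤ d ^
6` this gives `2466 = 6 * 411`. -/
lemma card_contours_le_exp {d : ℕ} (hd : 2 ≤ d) (r : Fin d → ℤ) (b : ℕ)
    (𝒢 : Finset (Finset (Fin d → ℤ)))
    (h𝒢 : ∀ F ∈ 𝒢, IsContour F ∧ r ∈ F ∧ (edgeBoundary F).card = b) :
    (𝒢.card : ℝ) ≤ Real.exp (2466 * (b * (Real.log d / d))) := by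
  have hd0 : (0 : ℝ) < d := by positivity
  have hd2 : (2 : ℝ) ≤ d := by exact_mod_cast hd
  have hlog : 0 < Real.log d := Real.log_pos (by linarith)
  rcases 𝒢.eq_empty_or_nonempty with rfl | ⟨F, hF⟩
  · simp [Real.exp_nonneg]
  have hb : 2 * d ≤ b := by
    obtain ⟨-, h2, h3⟩ := h𝒢 F hF
    exact h3 ▸ two_mul_le_card_edgeBoundary ⟨r, h2⟩
  set L := 410 * b / d
  have hL : (L : ℝ) + 1 ≤ 411 * (b / d) := by
    have h1 : (L : ℝ) ≤ ((410 * b : ℕ) : ℝ) / d := Nat.cast_div_le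
    have h2 : (1 : ℝ) ≤ b / d := by
      rw [le_div_iff₀ hd0]
      have : ((2 * d : ℕ) : ℝ) ≤ b := by exact_mod_cast hb
      push_cast at this
      linarith
    push_cast at h1
    rw [mul_div_assoc] at h1
    linarith
  have h32 : (32 * d : ℝ) ≤ (d : ℝ) ^ 6 := by
    have : (2 : ℝ) ^ 5 ≤ (d : ℝ) ^ 5 := pow_le_pow_left₀ (by norm_num) hd2 5
    nlinarith
  have h1 : (𝒢.card : ℝ) ≤ (32 * d : ℝ) ^ (L + 1) := by
    have h2 : 𝒢.card ≤ (32 * d) ^ (L + 1) := by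
      refine (card_contours_le hd r b 𝒢 h𝒢).trans ?_
      rw [show 32 * d = 2 * d * 16 by ring, mul_pow _ 16]
      exact Nat.mul_le_mul_right _ (Nat.pow_le_pow_right (by omega) (Nat.le_succ _))
    exact_mod_cast h2
  calc (𝒢.card : ℝ) ≤ ((d : ℝ) ^ 6) ^ (L + 1) := h1.trans (pow_le_pow_left₀ (by positivity) h32 _)
    _ = Real.exp (6 * Real.log d * (L + 1)) := by
      rw [← pow_mul, ← Real.rpow_natCast, Real.rpow_def_of_pos hd0]
      push_cast
      ring_nf
    _ ≤ _ := by
      refine Real.exp_le_exp.2 ?_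
      calc 6 * Real.log d * (L + 1) ≤ 6 * Real.log d * (411 * (b / d)) := by gcongr
        _ = _ := by ring

/-- The choice `q = 1 - 1 / d` balances the two factors: a unit of the sum costs at most `2 / d`,
and each of the at most `lam / d` entries costs at most `2 * log d`. -/
lemma card_sequences_le_exp {d N : ℕ} (hd : 2 ≤ d) {lam : ℝ} (hlam : 0 < lam)
    (hN : (d * N : ℝ) ≤ lam) (S : Finset (Fin N → ℤ))
    (hS : ∀ w ∈ S, ((∑ i, (w i).natAbs : ℕ) : ℝ) ≤ 2 * lam) :
    (S.card : ℝ) ≤ Real.exp (10 * (lam * (Real.log d / d))) := by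
  have hd0 : (0 : ℝ) < d := by positivity
  have hd2 : (2 : ℝ) ≤ d := by exact_mod_cast hd
  have hl := one_le_two_mul_log hd
  have hq0 : (0 : ℝ) < 1 - 1 / d := by
    rw [sub_pos, div_lt_one hd0]; linarith
  have hq1 : 1 - 1 / (d : ℝ) < 1 := by
    have : 0 < 1 / (d : ℝ) := by positivity
    linarith
  have h1 := card_sequences_le hq0 hq1 S hS
  have hlogq : -Real.log (1 - 1 / (d : ℝ)) ≤ 2 / d := by
    have h2 := Real.one_sub_inv_le_log_of_pos hq0
    have h3 : (1 - 1 / (d : ℝ))⁻¹ ≤ 1 + 2 / d := by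
      rw [inv_le_iff_one_le_mul₀ hq0]
      have h4 : 1 / (d : ℝ) ≤ 1 / 2 := one_div_le_one_div_of_le (by norm_num) hd2
      have h5 : (0 : ℝ) < 1 / d := by positivity
      have h6 : (2 : ℝ) / d = 2 * (1 / d) := by ring
      rw [h6]
      nlinarith
    linarith
  have hZ : ((1 + (1 - 1 / (d : ℝ))) / (1 - (1 - 1 / d))) ≤ (d : ℝ) ^ 2 := by
    have : ((1 + (1 - 1 / (d : ℝ))) / (1 - (1 - 1 / d))) = 2 * d - 1 := by
      field_simp
      ring
    rw [this]
    nlinarith [sq_nonneg ((d : ℝ) - 1)]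
  have hZ0 : 0 ≤ ((1 + (1 - 1 / (d : ℝ))) / (1 - (1 - 1 / d))) :=
    div_nonneg (by linarith) (by linarith)
  have hN' : (N : ℝ) ≤ lam / d := by
    rw [le_div_iff₀ hd0]; linarith
  have h7 : ((1 + (1 - 1 / (d : ℝ))) / (1 - (1 - 1 / d))) ^ N ≤
      Real.exp (2 * (lam * (Real.log d / d))) := by
    refine (pow_le_pow_left₀ hZ0 hZ N).trans ?_
    rw [← pow_mul, ← Real.rpow_natCast, Real.rpow_def_of_pos hd0]
    refine Real.exp_le_exp.2 ?_
    push_cast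
    calc Real.log d * (2 * N) ≤ Real.log d * (2 * (lam / d)) := by gcongr
      _ = _ := by ring
  have h8 : 2 * lam * -Real.log (1 - 1 / (d : ℝ)) ≤ 8 * (lam * (Real.log d / d)) := by
    calc 2 * lam * -Real.log (1 - 1 / (d : ℝ)) ≤ 2 * lam * (2 / d) := by gcongr
      _ = 4 * (lam / d) * 1 := by ring
      _ ≤ 4 * (lam / d) * (2 * Real.log d) := by gcongr
      _ = _ := by ring
  calc (S.card : ℝ) ≤ _ := h1
    _ ≤ Real.exp (8 * (lam * (Real.log d / d))) * Real.exp (2 * (lam * (Real.log d / d))) := by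
      gcongr
    _ = _ := by
      rw [← Real.exp_add]
      ring_nf

/-- Counting shifts with given representatives, boundary sizes and jumps. -/
lemma card_shifts_fiber_le {d N : ℕ} (hd : 2 ≤ d) {lam : ℝ} (𝒯 : Finset (Shift d))
    (w : Fin N → Fin d → ℤ) (a : Dir d) (b Δ : Fin N → ℤ)
    (h𝒯 : ∀ τ ∈ 𝒯, (totalVariation τ : ℝ) ≤ lam ∧ IsTransversal τ w ∧
      (∀ i, ((edgeBoundary (hull τ (w i))).card : ℤ) = b i) ∧
      ∀ i, τ (exitPoint a (hull τ (w i))) - τ (exitPoint a (hull τ (w i)) + stepVec a) = Δ i) :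
    (𝒯.card : ℝ) ≤ Real.exp (4932 * (lam * (Real.log d / d))) := by
  classical
  have hd2 : (2 : ℝ) ≤ d := by exact_mod_cast hd
  have hlog : 0 < Real.log d := Real.log_pos (by linarith)
  rcases 𝒯.eq_empty_or_nonempty with rfl | ⟨τ₀, hτ₀⟩
  · simp [Real.exp_nonneg]
  let 𝒢 : Fin N → Finset (Finset (Fin d → ℤ)) := fun i => 𝒯.image fun τ => hull τ (w i)
  have h1 : 𝒯.card ≤ (Fintype.piFinset 𝒢).card := by
    refine Finset.card_le_card_of_injOn (fun τ i => hull τ (w i)) ?_ ?_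
    · intro τ hτ
      rw [Finset.mem_coe, Fintype.mem_piFinset]
      exact fun i => Finset.mem_image_of_mem _ hτ
    · intro τ hτ τ' hτ' he
      obtain ⟨-, h2, -, h3⟩ := h𝒯 τ hτ
      obtain ⟨-, h2', -, h3'⟩ := h𝒯 τ' hτ'
      exact h2.eq_of_hull hd h2' a (congrFun he) fun i => (h3 i).trans (h3' i).symm
  have h2 : ∀ i, ((𝒢 i).card : ℝ) ≤ Real.exp (2466 * ((b i).toNat * (Real.log d / d))) := by
    intro i
    refine card_contours_le_exp hd (w i) _ _ fun F hF => ?_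
    obtain ⟨τ, hτ, rfl⟩ := Finset.mem_image.1 hF
    obtain ⟨-, h2, h3, -⟩ := h𝒯 τ hτ
    refine ⟨isContour_hull hd (h2.finite i), self_mem_hull hd (h2.finite i), ?_⟩
    rw [← h3 i, Int.toNat_natCast]
  have h3 : ((∑ i, (b i).toNat : ℕ) : ℝ) ≤ 2 * lam := by
    obtain ⟨h4, h5, h6, -⟩ := h𝒯 τ₀ hτ₀
    have h7 := h5.sum_card_edgeBoundary_le hd
    have h8 : ∑ i, (b i).toNat = ∑ i, (edgeBoundary (hull τ₀ (w i))).card :=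
      Finset.sum_congr rfl fun i _ => by rw [← h6 i, Int.toNat_natCast]
    rw [h8]
    have : ((∑ i, (edgeBoundary (hull τ₀ (w i))).card : ℕ) : ℝ) ≤ ((2 * totalVariation τ₀ : ℕ) : ℝ) :=
      by exact_mod_cast h7
    push_cast at this ⊢
    linarith
  calc (𝒯.card : ℝ) ≤ ((Fintype.piFinset 𝒢).card : ℝ) := by exact_mod_cast h1
    _ = ∏ i, ((𝒢 i).card : ℝ) := by rw [Fintype.card_piFinset]; push_cast; rfl
    _ ≤ ∏ i, Real.exp (2466 * ((b i).toNat * (Real.log d / d))) :=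
      Finset.prod_le_prod (fun _ _ => by positivity) fun i _ => h2 i
    _ = Real.exp (2466 * (((∑ i, (b i).toNat : ℕ) : ℝ) * (Real.log d / d))) := by
      rw [← Real.exp_sum, ← Finset.mul_sum, ← Finset.sum_mul]
      push_cast
      rfl
    _ ≤ Real.exp (2466 * (2 * lam * (Real.log d / d))) := by gcongr
    _ = _ := by ring_nf

/-- Counting shifts with a given number of finite level components. -/
lemma card_shifts_le_of_transversal {d N : ℕ} (hd : 2 ≤ d) {lam rho q : ℝ} (hlam : 0 < lam)
    (h0 : 0 < q) (h1 : q < 1) (hN : (d * N : ℝ) ≤ lam) (𝒯 : Finset (Shift d))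
    (h𝒯 : ∀ τ ∈ 𝒯, (totalVariation τ : ℝ) ≤ lam ∧ ∃ w : Fin N → Fin d → ℤ, IsTransversal τ w ∧
      (pathLen 0 (List.ofFn w) : ℝ) ≤ rho) :
    (𝒯.card : ℝ) ≤ Real.exp (4952 * (lam * (Real.log d / d))) *
      Real.exp (rho * -Real.log q + lam * Real.log ((1 + q) / (1 - q))) := by
  classical
  choose! w hw hwlen using fun τ hτ => (h𝒯 τ hτ).2
  let a : Dir d := (⟨0, by omega⟩, true)
  -- Boundary sizes are kept as integers so that one count of integer sequences serves for them and
  -- for the jumps.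
  let b : Shift d → Fin N → ℤ := fun τ i => (edgeBoundary (hull τ (w τ i))).card
  let Δ : Shift d → Fin N → ℤ := fun τ i =>
    τ (exitPoint a (hull τ (w τ i))) - τ (exitPoint a (hull τ (w τ i)) + stepVec a)
  have hcast : ∀ (τ : Shift d) (n : ℕ), τ ∈ 𝒯 → n ≤ 2 * totalVariation τ → (n : ℝ) ≤ 2 * lam := by
    intro τ n hτ hn
    have h2 := (h𝒯 τ hτ).1
    have h3 : (n : ℝ) ≤ ((2 * totalVariation τ : ℕ) : ℝ) := by exact_mod_cast hn
    push_cast at h3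
    linarith
  have hW : ((𝒯.image w).card : ℝ) ≤
      Real.exp (rho * -Real.log q + lam * Real.log ((1 + q) / (1 - q))) := by
    have h2 := card_trips_le (m := rho) h0 h1 (𝒯.image w) fun v hv => by
      obtain ⟨τ, hτ, rfl⟩ := Finset.mem_image.1 hv
      exact hwlen τ hτ
    refine h2.trans ?_
    have hZ : 1 ≤ (1 + q) / (1 - q) := by
      rw [le_div_iff₀ (by linarith)]; linarith
    rw [Real.exp_add, ← Real.rpow_natCast, Real.rpow_def_of_pos (by linarith)]
    have h3 := Real.log_nonneg hZ
    have h4 : ((d * N : ℕ) : ℝ) ≤ lam := by push_cast; exact hN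
    refine mul_le_mul_of_nonneg_left (Real.exp_le_exp.2 ?_) (Real.exp_pos _).le
    rw [mul_comm]
    exact mul_le_mul_of_nonneg_right h4 h3
  have hB : ((𝒯.image b).card : ℝ) ≤ Real.exp (10 * (lam * (Real.log d / d))) := by
    refine card_sequences_le_exp hd hlam hN _ fun v hv => ?_
    obtain ⟨τ, hτ, rfl⟩ := Finset.mem_image.1 hv
    exact hcast τ _ hτ (by simpa [b] using (hw τ hτ).sum_card_edgeBoundary_le hd)
  have hD : ((𝒯.image Δ).card : ℝ) ≤ Real.exp (10 * (lam * (Real.log d / d))) := by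
    refine card_sequences_le_exp hd hlam hN _ fun v hv => ?_
    obtain ⟨τ, hτ, rfl⟩ := Finset.mem_image.1 hv
    exact hcast τ _ hτ ((hw τ hτ).sum_jump_le hd a)
  have hsum : (𝒯.card : ℝ) ≤ ((𝒯.image w ×ˢ 𝒯.image b ×ˢ 𝒯.image Δ).card : ℝ) *
      Real.exp (4932 * (lam * (Real.log d / d))) := by
    rw [Finset.card_eq_sum_card_fiberwise (f := fun τ => (w τ, b τ, Δ τ))
      (t := 𝒯.image w ×ˢ 𝒯.image b ×ˢ 𝒯.image Δ) fun τ hτ => by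
        simp only [Finset.coe_product, Set.mem_prod, Finset.mem_coe]
        exact ⟨Finset.mem_image_of_mem _ hτ, Finset.mem_image_of_mem _ hτ,
          Finset.mem_image_of_mem _ hτ⟩]
    push_cast
    rw [← nsmul_eq_mul]
    refine Finset.sum_le_card_nsmul _ _ _ ?_
    rintro ⟨w', b', Δ'⟩ -
    refine card_shifts_fiber_le hd _ w' a b' Δ' fun τ hτ => ?_
    obtain ⟨hmem, he⟩ := Finset.mem_filter.1 hτ
    simp only [Prod.mk.injEq] at he
    obtain ⟨rfl, rfl, rfl⟩ := he
    exact ⟨(h𝒯 τ hmem).1, hw τ hmem, fun i => rfl, fun i => rfl⟩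
  rw [Finset.card_product, Finset.card_product] at hsum
  push_cast at hsum
  set R := Real.exp (rho * -Real.log q + lam * Real.log ((1 + q) / (1 - q)))
  calc (𝒯.card : ℝ) ≤ _ := hsum
    _ ≤ R * (Real.exp (10 * (lam * (Real.log d / d))) * Real.exp (10 * (lam * (Real.log d / d)))) *
        Real.exp (4932 * (lam * (Real.log d / d))) := by gcongr
    _ = (Real.exp (10 * (lam * (Real.log d / d))) * Real.exp (10 * (lam * (Real.log d / d))) *
        Real.exp (4932 * (lam * (Real.log d / d)))) * R := by ring
    _ = _ := by
      rw [← Real.exp_add, ← Real.exp_add]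
      ring_nf

/-- The number of finite components takes at most `⌊lam / d⌋₊ + 1` values; summing over it raises
the constant from `4952` to `4954`. -/
lemma card_shifts_le {d : ℕ} (hd : 2 ≤ d) {lam rho q : ℝ} (hlam : 0 < lam)
    (h0 : 0 < q) (h1 : q < 1) (𝒯 : Finset (Shift d))
    (h𝒯 : ∀ τ ∈ 𝒯, (totalVariation τ : ℝ) ≤ lam ∧ (tripEntropy τ : ℝ) ≤ rho) :
    (𝒯.card : ℝ) ≤ Real.exp (4954 * (lam * (Real.log d / d)) +
      (rho * -Real.log q + lam * Real.log ((1 + q) / (1 - q)))) := by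
  classical
  have hd0 : (0 : ℝ) < d := by positivity
  choose N w hw hlen using fun τ : Shift d => exists_isTransversal τ
  have hN : ∀ τ ∈ 𝒯, (d * N τ : ℝ) ≤ lam := by
    intro τ hτ
    have h2 := (hw τ).sum_card_edgeBoundary_le hd
    have h3 : N τ * (2 * d) ≤ ∑ i, (edgeBoundary (hull τ (w τ i))).card := by
      have := Finset.card_nsmul_le_sum Finset.univ
        (fun i => (edgeBoundary (hull τ (w τ i))).card) (2 * d) fun i _ =>
          two_mul_le_card_edgeBoundary ⟨_, self_mem_hull hd ((hw τ).finite i)⟩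
      simpa using this
    have h4 : d * N τ ≤ totalVariation τ := by linarith
    have h5 : ((d * N τ : ℕ) : ℝ) ≤ totalVariation τ := by exact_mod_cast h4
    push_cast at h5
    exact h5.trans (h𝒯 τ hτ).1
  have hmaps : ∀ τ ∈ 𝒯, N τ ∈ Finset.range (⌊lam / d⌋₊ + 1) := by
    intro τ hτ
    rw [Finset.mem_range, Nat.lt_succ_iff]
    refine Nat.le_floor ?_
    rw [le_div_iff₀ hd0]
    linarith [hN τ hτ]
  set R := rho * -Real.log q + lam * Real.log ((1 + q) / (1 - q))
  have hsum : (𝒯.card : ℝ) ≤ ((Finset.range (⌊lam / d⌋₊ + 1)).card : ℝ) *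
      (Real.exp (4952 * (lam * (Real.log d / d))) * Real.exp R) := by
    rw [Finset.card_eq_sum_card_fiberwise hmaps]
    push_cast
    rw [← nsmul_eq_mul]
    refine Finset.sum_le_card_nsmul _ _ _ fun n _ => ?_
    rcases (𝒯.filter fun τ => N τ = n).eq_empty_or_nonempty with he | ⟨τ₀, hτ₀⟩
    · rw [he]
      simp only [Finset.card_empty, Nat.cast_zero]
      positivity
    obtain ⟨hmem, rfl⟩ := Finset.mem_filter.1 hτ₀
    refine card_shifts_le_of_transversal hd hlam h0 h1 (hN τ₀ hmem) _ fun τ hτ => ?_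
    obtain ⟨hτ, he⟩ := Finset.mem_filter.1 hτ
    refine ⟨(h𝒯 τ hτ).1, ?_⟩
    rw [← he]
    exact ⟨w τ, hw τ, le_trans (by exact_mod_cast hlen τ) (h𝒯 τ hτ).2⟩
  have hcard : ((Finset.range (⌊lam / d⌋₊ + 1)).card : ℝ) ≤
      Real.exp (2 * (lam * (Real.log d / d))) := by
    rw [Finset.card_range]
    push_cast
    have h2 : (⌊lam / d⌋₊ : ℝ) ≤ lam / d := Nat.floor_le (by positivity)
    have h3 := Real.add_one_le_exp (lam / d)
    have h4 : lam / d ≤ 2 * (lam * (Real.log d / d)) := by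
      calc lam / d = lam / d * 1 := (mul_one _).symm
        _ ≤ lam / d * (2 * Real.log d) := by
          gcongr
          exact one_le_two_mul_log hd
        _ = _ := by ring
    have h5 := Real.exp_le_exp.2 h4
    linarith
  calc (𝒯.card : ℝ) ≤ _ := hsum
    _ ≤ Real.exp (2 * (lam * (Real.log d / d))) *
        (Real.exp (4952 * (lam * (Real.log d / d))) * Real.exp R) := by gcongr
    _ = _ := by
      rw [← Real.exp_add, ← Real.exp_add]
      ring_nf

/-- With `q = rho / (rho + lam)` the trip length costs at most `lam`, and `(1 + q) / (1 - q)` equals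
`2 * (rho / lam) + 1`. -/
lemma card_shifts_le_first {d : ℕ} (hd : 2 ≤ d) {lam rho : ℝ} (hlam : 0 < lam) (hrho : 0 < rho)
    (𝒯 : Finset (Shift d))
    (h𝒯 : ∀ τ ∈ 𝒯, (totalVariation τ : ℝ) ≤ lam ∧ (tripEntropy τ : ℝ) ≤ rho) :
    (𝒯.card : ℝ) ≤ Real.exp (5000 * (lam + lam * Real.log (rho / lam + 1))) := by
  have hd0 : (0 : ℝ) < d := by positivity
  have hq1 : rho / (rho + lam) < 1 := by
    rw [div_lt_one (by positivity)]; linarith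
  refine (card_shifts_le hd hlam (by positivity : 0 < rho / (rho + lam)) hq1 𝒯 h𝒯).trans
    (Real.exp_le_exp.2 ?_)
  have h1 : Real.log d / d ≤ 1 := by
    rw [div_le_one hd0]
    exact (Real.log_le_sub_one_of_pos hd0).trans (by linarith)
  have h2 : rho * -Real.log (rho / (rho + lam)) ≤ lam := by
    rw [← Real.log_inv, inv_div]
    have h3 := Real.log_le_sub_one_of_pos (show 0 < (rho + lam) / rho by positivity)
    have h4 : (rho + lam) / rho - 1 = lam / rho := by field_simp; ring
    rw [h4] at h3
    calc rho * Real.log ((rho + lam) / rho) ≤ rho * (lam / rho) := by gcongr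
      _ = lam := by field_simp
  have h5 : Real.log ((1 + rho / (rho + lam)) / (1 - rho / (rho + lam))) ≤
      1 + Real.log (rho / lam + 1) := by
    have h6 : (1 + rho / (rho + lam)) / (1 - rho / (rho + lam)) = 2 * (rho / lam) + 1 := by
      have : rho + lam - rho ≠ 0 := by simpa using hlam.ne'
      field_simp
      ring
    rw [h6]
    have h7 : 0 < rho / lam := by positivity
    calc Real.log (2 * (rho / lam) + 1) ≤ Real.log (2 * (rho / lam + 1)) :=
          Real.log_le_log (by positivity) (by linarith)
      _ = Real.log 2 + Real.log (rho / lam + 1) := Real.log_mul (by norm_num) (by positivity)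
      _ ≤ _ := by
        have := Real.log_two_lt_d9
        linarith
  have h8 : 0 ≤ lam * Real.log (rho / lam + 1) := by
    have : 0 < rho / lam := by positivity
    exact mul_nonneg hlam.le (Real.log_nonneg (by linarith))
  have h9 : lam * (Real.log d / d) ≤ lam := by
    simpa using mul_le_mul_of_nonneg_left h1 hlam.le
  have h10 := mul_le_mul_of_nonneg_left h5 hlam.le
  rw [mul_add, mul_one] at h10
  linarith

/-- With `q = 1 / d ^ 2` each unit of trip length costs `2 * log d`, while `log ((1 + q) / (1 - q))`
is at most `4 / d ^ 2`, which the contour term absorbs. -/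
lemma card_shifts_le_second {d : ℕ} (hd : 2 ≤ d) {lam rho : ℝ} (hlam : 0 < lam) (hrho : 0 < rho)
    (𝒯 : Finset (Shift d))
    (h𝒯 : ∀ τ ∈ 𝒯, (totalVariation τ : ℝ) ≤ lam ∧ (tripEntropy τ : ℝ) ≤ rho) :
    (𝒯.card : ℝ) ≤ Real.exp (5000 * (lam * (Real.log d / d) + rho * Real.log d)) := by
  have hd0 : (0 : ℝ) < d := by positivity
  have hd2 : (2 : ℝ) ≤ d := by exact_mod_cast hd
  have hl := one_le_two_mul_log hd
  have hq : (1 : ℝ) / d ^ 2 ≤ 1 / 4 := one_div_le_one_div_of_le (by norm_num) (by nlinarith)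
  have hq0 : (0 : ℝ) < 1 / d ^ 2 := by positivity
  refine (card_shifts_le hd hlam hq0 (by linarith) 𝒯 h𝒯).trans (Real.exp_le_exp.2 ?_)
  have h1 : -Real.log (1 / (d : ℝ) ^ 2) = 2 * Real.log d := by
    rw [one_div, Real.log_inv, Real.log_pow]
    push_cast
    ring
  have h2 : Real.log ((1 + 1 / (d : ℝ) ^ 2) / (1 - 1 / d ^ 2)) ≤ 4 * (1 / d ^ 2) := by
    have h3 : (1 + 1 / (d : ℝ) ^ 2) / (1 - 1 / d ^ 2) ≤ 1 + 4 * (1 / d ^ 2) := by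
      rw [div_le_iff₀ (by linarith)]
      nlinarith
    have h4 := Real.log_le_sub_one_of_pos
      (show 0 < (1 + 1 / (d : ℝ) ^ 2) / (1 - 1 / d ^ 2) from
        div_pos (by linarith) (by linarith))
    linarith
  have h5 : 4 * (1 / (d : ℝ) ^ 2) ≤ 4 * (Real.log d / d) := by
    have h6 : 1 / (d : ℝ) ^ 2 = 1 / d / d := by rw [div_div, sq]
    rw [h6]
    have h7 : 1 / (d : ℝ) ≤ Real.log d := by
      have : 1 / (d : ℝ) ≤ 1 / 2 := one_div_le_one_div_of_le (by norm_num) hd2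
      linarith
    gcongr
  have h8 := mul_le_mul_of_nonneg_left (h2.trans h5) hlam.le
  have h9 : 0 ≤ rho * Real.log d := mul_nonneg hrho.le (by linarith)
  have h10 : 0 ≤ lam * (Real.log d / d) := mul_nonneg hlam.le (div_nonneg (by linarith) hd0.le)
  rw [h1]
  linarith

end LatticeShift

theorem mainTheorem9 :
    ∃ C : ℝ, 0 < C ∧ ∀ d : ℕ, 2 ≤ d → ∀ lam rho : ℝ, 0 < lam → 0 < rho →
      {τ : LatticeShift.Shift d | (LatticeShift.totalVariation τ : ℝ) ≤ lam ∧
        (LatticeShift.tripEntropy τ : ℝ) ≤ rho}.Finite ∧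
      ({τ : LatticeShift.Shift d | (LatticeShift.totalVariation τ : ℝ) ≤ lam ∧
        (LatticeShift.tripEntropy τ : ℝ) ≤ rho}.ncard : ℝ) ≤
        Real.exp (C * min (lam + lam * Real.log (rho / lam + 1))
          (lam * (Real.log d / d) + rho * Real.log d)) := by
  refine ⟨5000, by norm_num, fun d hd lam rho hlam hrho => ?_⟩
  set 𝒮 := {τ : LatticeShift.Shift d | (LatticeShift.totalVariation τ : ℝ) ≤ lam ∧
    (LatticeShift.tripEntropy τ : ℝ) ≤ rho}
  set M := Real.exp (5000 * min (lam + lam * Real.log (rho / lam + 1))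
    (lam * (Real.log d / d) + rho * Real.log d)) with hM
  -- A uniform bound on finite subfamilies yields both the finiteness and the cardinality estimate.
  have key : ∀ 𝒯 : Finset (LatticeShift.Shift d), (𝒯 : Set (LatticeShift.Shift d)) ⊆ 𝒮 →
      (𝒯.card : ℝ) ≤ M := by
    intro 𝒯 h𝒯
    rw [hM, mul_min_of_nonneg _ _ (by norm_num), Real.exp_monotone.map_min]
    exact le_min (LatticeShift.card_shifts_le_first hd hlam hrho 𝒯 fun τ hτ => h𝒯 hτ)
      (LatticeShift.card_shifts_le_second hd hlam hrho 𝒯 fun τ hτ => h𝒯 hτ)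
  have hfin : 𝒮.Finite := by
    by_contra hinf
    obtain ⟨𝒯, h𝒯, hcard⟩ := Set.Infinite.exists_subset_card_eq hinf (⌊M⌋₊ + 1)
    have h1 := key 𝒯 h𝒯
    have h2 := Nat.lt_floor_add_one M
    rw [hcard] at h1
    push_cast at h1
    linarith
  refine ⟨hfin, ?_⟩
  rw [Set.ncard_eq_toFinset_card _ hfin]
  exact key _ (by simp)
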